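/- Let $f\colon S^n\to S^m$ be a smooth map between Euclidean unit spheres and let $\theta\in(0,\pi/2)$ be such that $$M_{f,\theta}=\{(\cos\theta\cdot x,\ \sin\theta\cdot f(x)) : x\in S^n\}$$ is a minimal submanifold of the unit sphere $S^{m+n+1}\subset\mathbb R^{m+n+2}$. Assume that at every $x\in S^n$ all nonzero singular values of the differential $f_{*x}\colon T_xS^n\to T_{f(x)}S^m$ are equal, that $f_{*x}$ has rank $p$ at every $x\in S^n$, that the $m+1$ components of $f$ are spherical harmonics of degree $k$ (restrictions to $S^n$ of harmonic homogeneous polynomials of degree $k$), and that $f$ is of Type (II), that is, either $(n,p)=(3,2)$ and $k\ge 4$, or $(n,p)=(5,4)$ and $k\ge 6$. Then the Lawson–Osserman cone $$C_{f,\theta}=\{r\,q : r>0,\ q\in M_{f,\theta}\}\subset\mathbb R^{m+n+2}$$ is unstable as a minimal submanifold: it is minimal (its mean curvature vanishes), and there is a smooth variation of $C_{f,\theta}$ in $\mathbb R^{m+n+2}$, with compact support in $C_{f,\theta}$ (in particular, away from the origin), along which the second derivative at $t=0$ of the $(n+1)$-dimensional volume (of a compact piece containing the support) exists and is negative. -/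

import Mathlib

open Real Set Filter Topology MeasureTheory Metric
open scoped ContDiff Manifold

noncomputable section

namespace LawsonOsserman

section General

variable {E A T : Type*}
  [NormedAddCommGroup E] [InnerProductSpace ℝ E] [FiniteDimensional ℝ E]
  [NormedAddCommGroup A] [InnerProductSpace ℝ A] [FiniteDimensional ℝ A]
  [NormedAddCommGroup T] [InnerProductSpace ℝ T] [FiniteDimensional ℝ T]

/-- The trace of a bilinear map `B` on `T` with respect to the inner product
`(u, v) ↦ ⟪L u, L v⟫` pulled back from `A` by an injective linear map `L`, that is `∑ g^{ij} B_{ij}`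
in a basis of `T`. -/
def metricTrace (L : T →ₗ[ℝ] A) (B : T → T → A) : A :=
  ∑ i, ∑ j,
    (Matrix.gram ℝ (fun l => L (stdOrthonormalBasis ℝ T l)))⁻¹ i j •
      B (stdOrthonormalBasis ℝ T i) (stdOrthonormalBasis ℝ T j)

/-- `F` is a minimal immersion of the open set `U` of a Euclidean space into the Euclidean
space `A`: a smooth immersion whose mean curvature vector (the normal part of
`∑ g^{ij} ∂ᵢ∂ⱼF`) vanishes at every point. -/
def IsMinimalImmersionOn (F : E → A) (U : Set E) : Prop :=
  ContDiffOn ℝ ∞ F U ∧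
  ∀ y ∈ U,
    Function.Injective (fderiv ℝ F y) ∧
    ((fderiv ℝ F y).toLinearMap.range)ᗮ.starProjection
      (metricTrace (fderiv ℝ F y).toLinearMap (fun u v => fderiv ℝ (fderiv ℝ F) y u v)) = 0

/-- The extension of a map on the unit sphere to the punctured space that is constant along rays:
`y ↦ g (y / ‖y‖)` (with value `0` at the origin). -/
def radialExt (g : sphere (0 : E) 1 → A) (y : E) : A :=
  open Classical in
  if h : y ≠ 0 then g ⟨‖y‖⁻¹ • y, by simp [norm_smul, h]⟩ else 0

/-- The tangent space of the unit sphere at `x`. -/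
abbrev sphereTangent (x : sphere (0 : E) 1) : Submodule ℝ E := (ℝ ∙ (x : E))ᗮ

/-- The differential at `x` of a map from the unit sphere to a Euclidean space. -/
def sphereDeriv (g : sphere (0 : E) 1 → A) (x : sphere (0 : E) 1) : sphereTangent x →ₗ[ℝ] A :=
  (fderiv ℝ (radialExt g) (x : E)).toLinearMap ∘ₗ (sphereTangent x).subtype

/-- The Hessian at `x` of a map from the unit sphere to a Euclidean space. For a tangent vector
`u` of length one, `sphereHessian g x u u` is the acceleration at `t = 0` of the curve
`t ↦ g (cos t • x + sin t • u)`. -/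
def sphereHessian (g : sphere (0 : E) 1 → A) (x : sphere (0 : E) 1)
    (u v : sphereTangent x) : A :=
  fderiv ℝ (fderiv ℝ (radialExt g)) (x : E) (u : E) (v : E)

/-- `ψ`, a smooth map from the unit sphere of `E`, is a minimal immersion into the unit sphere
of `A`: the component of `∑ g^{ij} (Hess ψ)_{ij}` that is tangent to the unit sphere of `A` and
normal to the image (the mean curvature vector) vanishes at every point. -/
def IsMinimalInUnitSphere (ψ : sphere (0 : E) 1 → A) : Prop :=
  ∀ x,
    ‖ψ x‖ = 1 ∧
    Function.Injective (sphereDeriv ψ x) ∧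
    ((sphereDeriv ψ x).range ⊔ (ℝ ∙ ψ x))ᗮ.starProjection
      (metricTrace (sphereDeriv ψ x) (sphereHessian ψ x)) = 0

/-- `Φ` is a smooth variation of `F : U → A` whose support is contained in the compact set
`K ⊆ U`. -/
structure IsCompactVariation (F : E → A) (U : Set E) (Φ : ℝ → E → A) (K : Set E) : Prop where
  smooth : ContDiffOn ℝ ∞ (fun q : ℝ × E => Φ q.1 q.2) (univ ×ˢ U)
  zero : ∀ y ∈ U, Φ 0 y = F y
  isCompact : IsCompact K
  subset : K ⊆ U
  fixed : ∀ t, ∀ y ∈ U, y ∉ K → Φ t y = F y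

variable [MeasurableSpace E] [BorelSpace E]

/-- The Riemannian volume of `F` over `K`: the integral of `√det(DFᵀ DF)`. -/
def volumeOver (F : E → A) (K : Set E) : ℝ :=
  ∫ y in K, (fderiv ℝ F y).toLinearMap.normDet

/-- The minimal immersion `F : U → A` is unstable: it is minimal, and there is a compactly
supported variation of `F` along which the volume function is twice differentiable at `0` with
negative second derivative. -/
def IsUnstableMinimal (F : E → A) (U : Set E) : Prop :=
  IsMinimalImmersionOn F U ∧
  ∃ (Φ : ℝ → E → A) (K : Set E), IsCompactVariation F U Φ K ∧
    ∃ (V' : ℝ → ℝ) (c : ℝ),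
      (∀ᶠ t in 𝓝 (0 : ℝ), HasDerivAt (fun s => volumeOver (Φ s) K) (V' t) t) ∧
      HasDerivAt V' c 0 ∧ c < 0

end General

/-- The unit sphere `Sⁿ` in `ℝⁿ⁺¹`. -/
abbrev S (n : ℕ) : Type := sphere (0 : EuclideanSpace ℝ (Fin (n + 1))) 1

/-- The Euclidean space `ℝ^{m+n+2} = ℝⁿ⁺¹ × ℝᵐ⁺¹`. -/
abbrev Ambient (n m : ℕ) : Type :=
  WithLp 2 (EuclideanSpace ℝ (Fin (n + 1)) × EuclideanSpace ℝ (Fin (m + 1)))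

variable {n m : ℕ}

/-- The map `x ↦ (cos θ · x, sin θ · f(x))` parametrizing `M_{f,θ}`. -/
def losMap (f : S n → S m) (θ : ℝ) (x : S n) : Ambient n m :=
  WithLp.toLp 2 (cos θ • (x : EuclideanSpace ℝ (Fin (n + 1))),
    sin θ • (f x : EuclideanSpace ℝ (Fin (m + 1))))

/-- `θ` is acute and `M_{f,θ}` is a minimal submanifold of the unit sphere `S^{m+n+1}`. -/
def IsLawsonOssermanSphere (f : S n → S m) (θ : ℝ) : Prop :=
  θ ∈ Ioo 0 (π / 2) ∧ IsMinimalInUnitSphere (losMap f θ)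

/-- Lawson–Osserman maps. -/
def IsLOM (f : S n → S m) : Prop :=
  ContMDiff (𝓡 n) (𝓡 m) ∞ f ∧ ∃ θ, IsLawsonOssermanSphere f θ

/-- The differential of `f : Sⁿ → Sᵐ` at `x`, with values in `ℝᵐ⁺¹ ⊇ T_{f(x)}Sᵐ`. -/
abbrev mapDeriv (f : S n → S m) (x : S n) :
    sphereTangent x →ₗ[ℝ] EuclideanSpace ℝ (Fin (m + 1)) :=
  sphereDeriv (fun z => (f z : EuclideanSpace ℝ (Fin (m + 1)))) x

/-- Lawson–Osserman maps such that, at every point, all nonzero singular values of the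
differential are equal. -/
def IsLOMSE (f : S n → S m) : Prop :=
  IsLOM f ∧ ∀ x, ∃ l : ℝ, ∀ i, (mapDeriv f x).singularValues i ≠ 0 →
    (mapDeriv f x).singularValues i = l

/-- `P` is a harmonic polynomial. -/
def IsHarmonicPoly {d : ℕ} (P : MvPolynomial (Fin d) ℝ) : Prop :=
  ∑ j, MvPolynomial.pderiv j (MvPolynomial.pderiv j P) = 0

/-- `f : Sⁿ → Sᵐ` is of `(n, p, k)`-type: its differential has rank `p` at every point (`p` is the
multiplicity of the nonzero singular value), and its components are spherical harmonics of degree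
`k` (restrictions of harmonic homogeneous polynomials of degree `k`). -/
def IsOfType (f : S n → S m) (p k : ℕ) : Prop :=
  (∀ x, Module.finrank ℝ (mapDeriv f x).range = p) ∧
  ∀ i : Fin (m + 1), ∃ P : MvPolynomial (Fin (n + 1)) ℝ,
    P.IsHomogeneous k ∧ IsHarmonicPoly P ∧
    ∀ x : S n, (f x : EuclideanSpace ℝ (Fin (m + 1))) i =
      MvPolynomial.eval (fun j => (x : EuclideanSpace ℝ (Fin (n + 1))) j) P

/-- The triples `(n, p, k)` of Type (II). -/
def IsTypeII (n p k : ℕ) : Prop :=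
  (n = 3 ∧ p = 2 ∧ 4 ≤ k) ∨ (n = 5 ∧ p = 4 ∧ 6 ≤ k)

/-- The immersion `y ↦ ‖y‖ · ψ(y/‖y‖)`, `ψ(x) = (cos θ · x, sin θ · f(x))`, of the punctured space
`ℝⁿ⁺¹ \ {0}` onto the open cone `C_{f,θ} = {r · q : r > 0, q ∈ M_{f,θ}}`. -/
def coneMap (f : S n → S m) (θ : ℝ) (y : EuclideanSpace ℝ (Fin (n + 1))) : Ambient n m :=
  ‖y‖ • radialExt (losMap f θ) y

end LawsonOsserman

end

/-! Minimality of the cone follows from minimality of its link (`isMinimalImmersionOn_cone`). For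
instability it is enough to vary the profile ray `(r cos θ, r sin θ)`, moving it by `t φ(r)` in the
normal direction `(-sin θ, cos θ)`.

Put `n = 2q + 1`, `p = 2q`, and let `Λ` be the common square of the nonzero singular values of the
differential of `f`. The components of `f` are harmonic polynomials `Pᵢ` with `∑ Pᵢ² = |y|^{2k}`.
Applying the Laplacian gives the energy density `k (k + n - 1)`, which is shared equally by `p`
singular values, so `Λ = k (k + n - 1) / p` (`sum_norm_sq_mapDeriv`, `exists_singular_frame`).

In the singular frame the volume density of the varied cone is `√(1 + t² φ'²) · W(t φ / r)`, where
`W` is `densityFactor` (`normDet_profileVariation`). The second variation is therefore `∫ (W(0) φ'²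
+ W''(0) φ² / r²)` over `ℝⁿ⁺¹` (`second_variation`). The sharp Hardy constant there is `((n - 1) /
2)² = q²`, so a suitable `φ` makes this negative once `W''(0) + q² W(0) < 0`
(`exists_test_function`).

Minimality of the link amounts to `W'(0) = 0`, that is, `cos² θ (Λ - 1) = Λ / (2q + 1)`
(`angle_equation`). With this value of `θ` the inequality reads `Λ > 9/2` for `q = 1` and `Λ > 25/2`
for `q = 2`. Type (II) gives `Λ ≥ 12` and `Λ ≥ 15` respectively. -/

namespace LawsonOsserman

/-! ### Linear algebra: metric traces, singular bases, norm determinants. -/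

section LinearAlgebra

variable {E A T : Type*}
  [NormedAddCommGroup E] [InnerProductSpace ℝ E] [FiniteDimensional ℝ E]
  [NormedAddCommGroup A] [InnerProductSpace ℝ A] [FiniteDimensional ℝ A]
  [NormedAddCommGroup T] [InnerProductSpace ℝ T] [FiniteDimensional ℝ T]

omit [FiniteDimensional ℝ A] in
-- If `M` is the change of basis matrix from `e` to `v` and `N` its inverse, the Gram matrix is `Mᵀ
-- M`, with inverse `N Nᵀ`. Contracting with it is the plain trace in a basis that is orthonormal
-- for the pulled back metric.
theorem metricTrace_eq_sum {ι : Type*} [Fintype ι] (L : T →ₗ[ℝ] A) (B : T →ₗ[ℝ] T →ₗ[ℝ] A)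
    (v : Module.Basis ι ℝ T) (hv : Orthonormal ℝ (fun i => L (v i))) :
    metricTrace L (fun u w => B u w) = ∑ i, B (v i) (v i) := by
  classical
  set e := (stdOrthonormalBasis ℝ T).toBasis with he
  have hee : ∀ i, stdOrthonormalBasis ℝ T i = e i := fun i => by simp [he]
  set N := e.toMatrix v
  set M := v.toMatrix e
  have hMN : M * N = 1 := v.toMatrix_mul_toMatrix_flip e
  have hNM : N * M = 1 := e.toMatrix_mul_toMatrix_flip v
  have hgram : Matrix.gram ℝ (fun l => L (stdOrthonormalBasis ℝ T l)) = M.transpose * M := by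
    ext i j
    have hexp : ∀ i, L (e i) = ∑ a, M a i • L (v a) := fun i => by
      rw [← v.sum_toMatrix_smul_self e i, map_sum]
      simp [M]
    simp only [Matrix.gram_apply, hee, Matrix.mul_apply, Matrix.transpose_apply]
    rw [hexp i, hexp j]
    simp only [sum_inner, inner_sum, inner_smul_left, inner_smul_right,
      orthonormal_iff_ite.1 hv]
    simp [mul_comm]
  have hinv : (Matrix.gram ℝ (fun l => L (stdOrthonormalBasis ℝ T l)))⁻¹ = N * N.transpose := by
    rw [hgram]
    apply Matrix.inv_eq_right_inv
    rw [Matrix.mul_assoc, ← Matrix.mul_assoc M, hMN, Matrix.one_mul, ← Matrix.transpose_mul, hNM,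
      Matrix.transpose_one]
  unfold metricTrace
  rw [hinv]
  have hv' : ∀ a, v a = ∑ i, N i a • e i := fun a => (e.sum_toMatrix_smul_self v a).symm
  calc _ = ∑ i, ∑ j, ∑ a, (N i a * N j a) • B (e i) (e j) := by
        simp only [Matrix.mul_apply, Matrix.transpose_apply, Finset.sum_smul, hee]
    _ = ∑ a, ∑ i, ∑ j, (N i a * N j a) • B (e i) (e j) := by
        conv_lhs => enter [2, i]; rw [Finset.sum_comm]
        exact Finset.sum_comm
    _ = _ := by
        refine Finset.sum_congr rfl fun a _ => ?_
        conv_rhs => rw [hv' a]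
        simp only [map_sum, LinearMap.sum_apply, map_smul, LinearMap.smul_apply, Finset.smul_sum,
          smul_smul]
        rw [Finset.sum_comm]
        exact Finset.sum_congr rfl fun _ _ => Finset.sum_congr rfl fun _ _ => by rw [mul_comm]

omit [FiniteDimensional ℝ A] in
theorem exists_basis_orthonormal_map (L : T →ₗ[ℝ] A) (hL : Function.Injective L) :
    ∃ v : Module.Basis (Fin (Module.finrank ℝ T)) ℝ T, Orthonormal ℝ (fun i => L (v i)) := by
  let e := LinearEquiv.ofInjective L hL
  have hr : Module.finrank ℝ L.range = Module.finrank ℝ T := e.finrank_eq.symm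
  let b := (stdOrthonormalBasis ℝ L.range).reindex (finCongr hr)
  refine ⟨b.toBasis.map e.symm, ?_⟩
  have h : ∀ i, L ((b.toBasis.map e.symm) i) = (b i : A) := fun i => by
    simp [e]
  simp only [h]
  exact b.orthonormal.comp_linearIsometry L.range.subtypeₗᵢ

theorem exists_orthonormalBasis_singularValues (L : T →ₗ[ℝ] A) {d : ℕ}
    (hd : Module.finrank ℝ T = d) :
    ∃ e : OrthonormalBasis (Fin d) ℝ T, ∀ i j,
      inner ℝ (L (e i)) (L (e j)) = if i = j then L.singularValues i ^ 2 else 0 := by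
  have hs := L.isSymmetric_adjoint_comp_self
  refine ⟨hs.eigenvectorBasis hd, fun i j => ?_⟩
  rw [L.sq_singularValues_fin hd, ← LinearMap.adjoint_inner_right]
  have := hs.apply_eigenvectorBasis hd j
  rw [LinearMap.comp_apply] at this
  rw [this, inner_smul_right, orthonormal_iff_ite.1 (hs.eigenvectorBasis hd).orthonormal]
  split_ifs with h <;> simp [h]

omit [FiniteDimensional ℝ A] in
theorem normDet_eq_prod_norm {ι : Type*} [Fintype ι] (L : T →ₗ[ℝ] A)
    (b : OrthonormalBasis ι ℝ T) (h : ∀ i j, i ≠ j → inner ℝ (L (b i)) (L (b j)) = 0) :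
    L.normDet = ∏ i, ‖L (b i)‖ := by
  classical
  have h1 := LinearMap.normDet_sq_eq_det_gram L b
  have h2 : Matrix.gram ℝ (fun i => L (b i)) = Matrix.diagonal fun i => ‖L (b i)‖ ^ 2 := by
    ext i j
    by_cases hij : i = j
    · subst hij; simp [Matrix.gram_apply]
    · simp [Matrix.gram_apply, hij, h i j hij]
  have h3 : L.normDet ^ 2 = (∏ i, ‖L (b i)‖) ^ 2 := by
    rw [← Finset.prod_pow, ← Matrix.det_diagonal, ← h2]
    exact h1
  exact (pow_left_inj₀ L.normDet_nonneg (Finset.prod_nonneg fun _ _ => norm_nonneg _)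
    two_ne_zero).1 h3

theorem sum_norm_sq_map_eq {ι κ : Type*} [Fintype ι] [Fintype κ] (L : T →ₗ[ℝ] A)
    (b : OrthonormalBasis ι ℝ T) (c : OrthonormalBasis κ ℝ T) :
    ∑ i, ‖L (b i)‖ ^ 2 = ∑ j, ‖L (c j)‖ ^ 2 := by
  have h : ∀ x, ‖L x‖ ^ 2 = inner ℝ x ((L.adjoint ∘ₗ L) x) := fun x => by
    rw [LinearMap.comp_apply, LinearMap.adjoint_inner_right, real_inner_self_eq_norm_sq]
  simp only [h]
  rw [← LinearMap.trace_eq_sum_inner, ← LinearMap.trace_eq_sum_inner]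

/-- Index convention for all adapted bases: `none` is the radial direction, `some i` are the
tangential ones. -/
theorem exists_basis_option {ι : Type*} [Fintype ι] (x : sphere (0 : E) 1)
    (v : Module.Basis ι ℝ (sphereTangent x)) :
    ∃ b : Module.Basis (Option ι) ℝ E, b none = x ∧ ∀ i, b (some i) = v i := by
  have hx : (x : E) ≠ 0 := ne_zero_of_mem_unit_sphere x
  let w : Option ι → E := fun o => o.elim (x : E) fun i => (v i : E)
  have hw : LinearIndependent ℝ w := by
    rw [linearIndependent_option]
    refine ⟨v.linearIndependent.map' (sphereTangent x).subtype (Submodule.ker_subtype _), ?_⟩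
    intro h
    have h2 : (x : E) ∈ sphereTangent x := by
      refine Submodule.span_le.2 ?_ h
      rintro _ ⟨i, rfl⟩
      exact (v i).2
    exact hx (inner_self_eq_zero.1 (Submodule.mem_orthogonal_singleton_iff_inner_right.1 h2))
  have hcard : Fintype.card (Option ι) = Module.finrank ℝ E := by
    rw [Fintype.card_option, ← Module.finrank_eq_card_basis v,
      ← (ℝ ∙ (x : E)).finrank_add_finrank_orthogonal, finrank_span_singleton hx, add_comm]
  exact ⟨basisOfLinearIndependentOfCardEqFinrank hw hcard, by simp [w], by simp [w]⟩

theorem exists_orthonormalBasis_option {ι : Type*} [Fintype ι] (x : sphere (0 : E) 1)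
    (v : OrthonormalBasis ι ℝ (sphereTangent x)) :
    ∃ b : OrthonormalBasis (Option ι) ℝ E, b none = x ∧ ∀ i, b (some i) = v i := by
  classical
  obtain ⟨b, hb, hb'⟩ := exists_basis_option x v.toBasis
  simp only [OrthonormalBasis.coe_toBasis] at hb'
  have ho : Orthonormal ℝ b := by
    have hxv : ∀ i, inner ℝ (x : E) (v i : E) = 0 := fun i =>
      Submodule.mem_orthogonal_singleton_iff_inner_right.1 (v i).2
    rw [orthonormal_iff_ite]
    rintro (_ | i) (_ | j)
    · simp [hb]
    · simp [hb, hb', hxv]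
    · simp [hb, hb', real_inner_comm, hxv]
    · have := orthonormal_iff_ite.1 v.orthonormal i j
      simpa [hb', Submodule.coe_inner] using this
  exact ⟨b.toOrthonormalBasis ho, by simpa using hb, by simpa using hb'⟩

end LinearAlgebra

/-! ### Calculus of homogeneous extensions and of unit-length maps. -/

section Calculus

variable {E A : Type*}
  [NormedAddCommGroup E] [InnerProductSpace ℝ E]
  [NormedAddCommGroup A] [InnerProductSpace ℝ A]

theorem inner_sphereTangent (x : sphere (0 : E) 1) (u : sphereTangent x) :
    inner ℝ (x : E) (u : E) = 0 :=
  Submodule.mem_orthogonal_singleton_iff_inner_right.1 u.2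

/-- The point of the unit sphere on the ray through `y`. -/
noncomputable def rayPoint (y : E) (hy : y ≠ 0) : sphere (0 : E) 1 := ⟨‖y‖⁻¹ • y, by simp [norm_smul, hy]⟩

theorem norm_smul_rayPoint (y : E) (hy : y ≠ 0) : ‖y‖ • (rayPoint y hy : E) = y := by
  simp [rayPoint, smul_smul, norm_ne_zero_iff.2 hy]

omit [InnerProductSpace ℝ A] in
theorem radialExt_of_ne_zero (g : sphere (0 : E) 1 → A) {y : E} (hy : y ≠ 0) :
    radialExt g y = g (rayPoint y hy) := by
  simp [radialExt, hy, rayPoint]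

theorem rayPoint_smul {r : ℝ} (hr : 0 < r) {y : E} (hy : y ≠ 0) (h : r • y ≠ 0) :
    rayPoint (r • y) h = rayPoint y hy := by
  ext1
  simp only [rayPoint, norm_smul, norm_of_nonneg hr.le, mul_inv, smul_smul]
  congr 1
  field_simp

omit [InnerProductSpace ℝ A] in
@[simp]
theorem radialExt_coe (g : sphere (0 : E) 1 → A) (x : sphere (0 : E) 1) :
    radialExt g (x : E) = g x := by
  have hx := ne_zero_of_mem_unit_sphere x
  rw [radialExt_of_ne_zero g hx]
  congr 1
  ext1
  simp [rayPoint]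

omit [InnerProductSpace ℝ A] in
theorem radialExt_smul (g : sphere (0 : E) 1 → A) {r : ℝ} (hr : 0 < r) (y : E) :
    radialExt g (r • y) = radialExt g y := by
  by_cases hy : y = 0
  · simp [hy]
  · have h : r • y ≠ 0 := smul_ne_zero hr.ne' hy
    rw [radialExt_of_ne_zero g h, radialExt_of_ne_zero g hy, rayPoint_smul hr hy]

/-- The chain rule for a single dilation. As the dilation is invertible, no differentiability of `F`
is needed, so the lemma can be iterated on `fderiv ℝ F`. -/
theorem fderiv_smul_of_homogeneous {B : Type*} [NormedAddCommGroup B] [NormedSpace ℝ B]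
    {F : E → B} {r : ℝ} (hr : r ≠ 0) {c : ℝ}
    (h : ∀ y, F (r • y) = c • F y) (y : E) :
    fderiv ℝ F (r • y) = (r⁻¹ * c) • fderiv ℝ F y := by
  have h1 := fderiv_comp_smul (f := F) (x := y) r
  rw [show (fun y => F (r • y)) = c • F from funext h, fderiv_const_smul_field] at h1
  rw [Pi.smul_apply] at h1
  rw [mul_smul, h1, smul_smul, inv_mul_cancel₀ hr, one_smul]

theorem fderiv_radialExt_smul (g : sphere (0 : E) 1 → A) {r : ℝ} (hr : 0 < r) (y : E) :
    fderiv ℝ (radialExt g) (r • y) = r⁻¹ • fderiv ℝ (radialExt g) y := by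
  simpa using fderiv_smul_of_homogeneous (c := 1) hr.ne'
    (fun y => by rw [radialExt_smul g hr, one_smul]) y

/-- Differentiating along a ray turns homogeneity into Euler identities. The three lemmas below
treat degree 0, degree 1, and the degree 0 derivative of a degree 1 map. -/
theorem hasDerivAt_ray {B : Type*} [NormedAddCommGroup B] [NormedSpace ℝ B] {F : E → B} {y : E} (hF : DifferentiableAt ℝ F y) :
    HasDerivAt (fun s : ℝ => F (s • y)) (fderiv ℝ F y y) 1 := by
  have h1 : HasDerivAt (fun s : ℝ => s • y) y 1 := by
    simpa using (hasDerivAt_id (1 : ℝ)).smul_const y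
  have h2 : HasFDerivAt F (fderiv ℝ F y) ((1 : ℝ) • y) := by
    rw [one_smul]; exact hF.hasFDerivAt
  exact h2.comp_hasDerivAt (1 : ℝ) h1

theorem fderiv_radialExt_self {g : sphere (0 : E) 1 → A} {y : E}
    (h : DifferentiableAt ℝ (radialExt g) y) : fderiv ℝ (radialExt g) y y = 0 := by
  refine (hasDerivAt_ray h).unique ((hasDerivAt_const (1 : ℝ) (radialExt g y)).congr_of_eventuallyEq ?_)
  filter_upwards [lt_mem_nhds one_pos] with s hs
  exact radialExt_smul g hs y

theorem fderiv_self_of_homogeneous {F : E → A} (hF : ∀ r : ℝ, 0 < r → ∀ y, F (r • y) = r • F y)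
    {y : E} (h : DifferentiableAt ℝ F y) : fderiv ℝ F y y = F y := by
  have h1 : HasDerivAt (fun s : ℝ => s • F y) (F y) 1 := by
    simpa using (hasDerivAt_id (1 : ℝ)).smul_const (F y)
  refine (hasDerivAt_ray h).unique (h1.congr_of_eventuallyEq ?_)
  filter_upwards [lt_mem_nhds one_pos] with s hs
  exact hF s hs y

theorem fderiv_fderiv_self_of_homogeneous {F : E → A}
    (hF : ∀ r : ℝ, 0 < r → ∀ y, F (r • y) = r • F y)
    {y : E} (h : DifferentiableAt ℝ (fderiv ℝ F) y) : fderiv ℝ (fderiv ℝ F) y y = 0 := by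
  refine (hasDerivAt_ray h).unique
    ((hasDerivAt_const (1 : ℝ) (fderiv ℝ F y)).congr_of_eventuallyEq ?_)
  filter_upwards [lt_mem_nhds one_pos] with s hs
  have := fderiv_smul_of_homogeneous hs.ne' (hF s hs) y
  rwa [inv_mul_cancel₀ hs.ne', one_smul] at this

theorem hasFDerivAt_fderiv_apply {h : E → A} {y : E} (hh : ContDiffAt ℝ 2 h y) (u : E) :
    HasFDerivAt (fun z => fderiv ℝ h z u) ((fderiv ℝ (fderiv ℝ h) y).flip u) y := by
  have h1 : HasFDerivAt (fderiv ℝ h) (fderiv ℝ (fderiv ℝ h) y) y :=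
    ((hh.fderiv_right (m := 1) (by norm_num)).differentiableAt (by norm_num)).hasFDerivAt
  simpa using h1.clm_apply (hasFDerivAt_const u y)

theorem ContDiffAt.eventually_differentiableAt {h : E → A} {y : E} (hh : ContDiffAt ℝ 2 h y) :
    ∀ᶠ z in 𝓝 y, DifferentiableAt ℝ h z :=
  (hh.eventually (by simp)).mono fun _ hz => hz.differentiableAt (by norm_num)

theorem inner_fderiv_of_unit {h : E → A} {y : E} (hh : DifferentiableAt ℝ h y)
    (h1 : ∀ᶠ z in 𝓝 y, ‖h z‖ = 1) (u : E) : inner ℝ (h y) (fderiv ℝ h y u) = 0 := by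
  have h2 := hh.hasFDerivAt.norm_sq
  have h3 : HasFDerivAt (fun z => ‖h z‖ ^ 2) (0 : E →L[ℝ] ℝ) y := by
    refine (hasFDerivAt_const (1 : ℝ) y).congr_of_eventuallyEq ?_
    filter_upwards [h1] with z hz
    simp [hz]
  have h4 := DFunLike.congr_fun (h2.unique h3) u
  simpa using h4

/-- Obtained by differentiating `⟪h, Dh u⟫ = 0` once more. It gives the radial parts of the Hessians
of `x` and `f(x)` without computing those Hessians. -/
theorem inner_fderiv_fderiv_of_unit {h : E → A} {y : E} (hh : ContDiffAt ℝ 2 h y)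
    (h1 : ∀ᶠ z in 𝓝 y, ‖h z‖ = 1) (u : E) :
    inner ℝ (h y) (fderiv ℝ (fderiv ℝ h) y u u) = -‖fderiv ℝ h y u‖ ^ 2 := by
  have hd := (hh.differentiableAt (by norm_num)).hasFDerivAt
  have h2 := hd.inner ℝ (hasFDerivAt_fderiv_apply hh u)
  have h3 : HasFDerivAt (fun z => inner ℝ (h z) (fderiv ℝ h z u)) (0 : E →L[ℝ] ℝ) y := by
    refine (hasFDerivAt_const (0 : ℝ) y).congr_of_eventuallyEq ?_
    filter_upwards [h1.eventually_nhds, ContDiffAt.eventually_differentiableAt hh] with z hz hz'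
    exact inner_fderiv_of_unit hz' hz u
  have h4 := DFunLike.congr_fun (h2.unique h3) u
  simp only [ContinuousLinearMap.comp_apply, ContinuousLinearMap.prod_apply,
    fderivInnerCLM_apply, ContinuousLinearMap.flip_apply, zero_apply,
    real_inner_self_eq_norm_sq] at h4
  linarith

theorem fderiv_norm_orthogonal (x : sphere (0 : E) 1) (u : E) (hu : inner ℝ (x : E) u = 0) :
    fderiv ℝ (fun y : E => ‖y‖) x u = 0 := by
  have hx := ne_zero_of_mem_unit_sphere x
  have h1 : HasFDerivAt (fun y : E => ‖y‖) (fderiv ℝ (fun y : E => ‖y‖) x) x :=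
    ((contDiffAt_norm ℝ hx (n := 1)).differentiableAt (by norm_num)).hasFDerivAt
  have h2 := (h1.pow 2).unique ((hasFDerivAt_id (x : E)).norm_sq)
  have h3 := DFunLike.congr_fun h2 u
  simpa [hu] using h3

/-- Up to multiples of the position vector, the second derivative of the cone `‖y‖ g(y / ‖y‖)` in
tangential directions is the Hessian of `g`. -/
theorem exists_fderiv_fderiv_cone_eq {g : sphere (0 : E) 1 → A} {x : sphere (0 : E) 1}
    (hg : ContDiffAt ℝ 2 (radialExt g) (x : E)) (u : sphereTangent x) :
    ∃ c : ℝ, fderiv ℝ (fderiv ℝ fun y => ‖y‖ • radialExt g y) (x : E) u u =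
      c • g x + sphereHessian g x u u := by
  have hx := ne_zero_of_mem_unit_sphere x
  have hN : ContDiffAt ℝ 2 (fun y : E => ‖y‖) x := contDiffAt_norm ℝ hx
  have hF : ContDiffAt ℝ 2 (fun y => ‖y‖ • radialExt g y) (x : E) := hN.smul hg
  have hN1 := (hN.differentiableAt (by norm_num)).hasFDerivAt
  have hg1 := (hg.differentiableAt (by norm_num)).hasFDerivAt
  have h1 := hasFDerivAt_fderiv_apply hF (u : E)
  have h2 := (hN1.smul (hasFDerivAt_fderiv_apply hg (u : E))).add
    ((hasFDerivAt_fderiv_apply hN (u : E)).smul hg1)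
  have h3 : (fun z => fderiv ℝ (fun y => ‖y‖ • radialExt g y) z (u : E)) =ᶠ[𝓝 (x : E)]
      fun z => ‖z‖ • fderiv ℝ (radialExt g) z (u : E) +
        fderiv ℝ (fun y : E => ‖y‖) z (u : E) • radialExt g z := by
    filter_upwards [ContDiffAt.eventually_differentiableAt hN,
      ContDiffAt.eventually_differentiableAt hg] with z hz1 hz2
    have h' : fderiv ℝ (fun y => ‖y‖ • radialExt g y) z (u : E) = _ :=
      DFunLike.congr_fun (hz1.hasFDerivAt.smul hz2.hasFDerivAt).fderiv (u : E)
    rw [h']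
    simp
  have h4 := DFunLike.congr_fun (h1.unique (h2.congr_of_eventuallyEq h3)) (u : E)
  have h0 := fderiv_norm_orthogonal x u (inner_sphereTangent x u)
  refine ⟨fderiv ℝ (fderiv ℝ (fun y : E => ‖y‖)) x u u, ?_⟩
  simp only [ContinuousLinearMap.flip_apply] at h4
  rw [h4]
  simp [h0, sphereHessian, add_comm]

theorem fderiv_cone_apply_tangent {g : sphere (0 : E) 1 → A} {x : sphere (0 : E) 1}
    (hg : DifferentiableAt ℝ (radialExt g) (x : E)) (u : sphereTangent x) :
    fderiv ℝ (fun y => ‖y‖ • radialExt g y) (x : E) u = sphereDeriv g x u := by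
  have hx := ne_zero_of_mem_unit_sphere x
  have hN : HasFDerivAt (fun y : E => ‖y‖) (fderiv ℝ (fun y : E => ‖y‖) x) x :=
    ((contDiffAt_norm ℝ hx (n := 1)).differentiableAt (by norm_num)).hasFDerivAt
  have h0 := fderiv_norm_orthogonal x u (inner_sphereTangent x u)
  have h' : fderiv ℝ (fun y => ‖y‖ • radialExt g y) (x : E) u = _ :=
    DFunLike.congr_fun (hN.smul hg.hasFDerivAt).fderiv (u : E)
  rw [h']
  simp [h0, sphereDeriv]

theorem contDiffAt_rayPoint {y : E} (hy : y ≠ 0) {k : WithTop ℕ∞} :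
    ContDiffAt ℝ k (fun y : E => ‖y‖⁻¹ • y) y :=
  ((contDiffAt_norm ℝ hy).inv (norm_ne_zero_iff.2 hy)).smul contDiffAt_id

theorem fderiv_normalize_orthogonal (x : sphere (0 : E) 1) (u : E) (hu : inner ℝ (x : E) u = 0) :
    fderiv ℝ (fun y : E => ‖y‖⁻¹ • y) x u = u := by
  have hx := ne_zero_of_mem_unit_sphere x
  have h1 : HasFDerivAt (fun y : E => ‖y‖⁻¹ • y) (fderiv ℝ (fun y : E => ‖y‖⁻¹ • y) x) x :=
    ((contDiffAt_rayPoint hx (k := 1)).differentiableAt (by norm_num)).hasFDerivAt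
  have hN : HasFDerivAt (fun y : E => ‖y‖) (fderiv ℝ (fun y : E => ‖y‖) x) x :=
    ((contDiffAt_norm ℝ hx (n := 1)).differentiableAt (by norm_num)).hasFDerivAt
  -- Differentiating the identity `‖y‖ • (‖y‖⁻¹ • y) = y` avoids the derivative of `‖y‖⁻¹`.
  have h2 : HasFDerivAt (fun y : E => ‖y‖ • ‖y‖⁻¹ • y) (ContinuousLinearMap.id ℝ E) x := by
    refine (hasFDerivAt_id (x : E)).congr_of_eventuallyEq ?_
    filter_upwards [isOpen_ne.mem_nhds hx] with z hz
    have : ‖z‖ ≠ 0 := norm_ne_zero_iff.2 hz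
    simp [smul_smul, this]
  have h3 := DFunLike.congr_fun ((hN.smul h1).unique h2) u
  simpa [fderiv_norm_orthogonal x u hu] using h3

theorem sphereDeriv_eq_fderiv {g : sphere (0 : E) 1 → A} {G : E → A} (hG : ∀ x, g x = G x)
    (x : sphere (0 : E) 1) (hd : DifferentiableAt ℝ G x) (u : sphereTangent x) :
    sphereDeriv g x u = fderiv ℝ G x u := by
  have hx := ne_zero_of_mem_unit_sphere x
  have h1 : HasFDerivAt (fun y : E => ‖y‖⁻¹ • y) (fderiv ℝ (fun y : E => ‖y‖⁻¹ • y) x) x :=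
    ((contDiffAt_rayPoint hx (k := 1)).differentiableAt (by norm_num)).hasFDerivAt
  have hxx : ‖(x : E)‖⁻¹ • (x : E) = x := by simp
  have h2 : HasFDerivAt G (fderiv ℝ G x) (‖(x : E)‖⁻¹ • (x : E)) := by
    rw [hxx]; exact hd.hasFDerivAt
  have h3 : radialExt g =ᶠ[𝓝 (x : E)] fun y => G (‖y‖⁻¹ • y) := by
    filter_upwards [isOpen_ne.mem_nhds hx] with z hz
    rw [radialExt_of_ne_zero g hz, hG]
    rfl
  have h4 := (HasFDerivAt.comp (f := fun y : E => ‖y‖⁻¹ • y) (x : E) h2 h1).congr_of_eventuallyEq h3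
  have h5 := DFunLike.congr_fun h4.fderiv (u : E)
  simp only [ContinuousLinearMap.comp_apply,
    fderiv_normalize_orthogonal x u (inner_sphereTangent x u)] at h5
  simpa [sphereDeriv] using h5

theorem contDiffAt_radialExt {g : sphere (0 : E) 1 → A} {G : E → A} (hG : ∀ x, g x = G x)
    {k : WithTop ℕ∞} (hd : ContDiff ℝ k G) {y : E} (hy : y ≠ 0) :
    ContDiffAt ℝ k (radialExt g) y := by
  have h3 : radialExt g =ᶠ[𝓝 y] fun y => G (‖y‖⁻¹ • y) := by
    filter_upwards [isOpen_ne.mem_nhds hy] with z hz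
    rw [radialExt_of_ne_zero g hz, hG]
    rfl
  exact (hd.contDiffAt.comp y (contDiffAt_rayPoint hy)).congr_of_eventuallyEq h3

end Calculus

/-! ### Cones over minimal submanifolds of the sphere. -/

section Cone

variable {E A : Type*}
  [NormedAddCommGroup E] [InnerProductSpace ℝ E] [FiniteDimensional ℝ E]
  [NormedAddCommGroup A] [InnerProductSpace ℝ A] [FiniteDimensional ℝ A]

omit [FiniteDimensional ℝ A] in
theorem injective_of_linearIndependent_map {ι T : Type*} [Fintype ι] [AddCommGroup T] [Module ℝ T]
    (L : T →ₗ[ℝ] A) (b : Module.Basis ι ℝ T) (h : LinearIndependent ℝ fun i => L (b i)) :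
    Function.Injective L := by
  rw [← LinearMap.ker_eq_bot, LinearMap.ker_eq_bot']
  intro w hw
  have h1 : ∑ i, b.repr w i • L (b i) = 0 := by
    rw [← hw]
    conv_rhs => rw [← b.sum_repr w, map_sum]
    simp
  have h2 := Fintype.linearIndependent_iff.1 h _ h1
  rw [← b.sum_repr w]
  simp [h2]

theorem starProjection_orthogonal_eq_zero_iff (K : Submodule ℝ A) (z : A) :
    Kᗮ.starProjection z = 0 ↔ z ∈ K := by
  rw [Submodule.starProjection_apply_eq_zero_iff, Submodule.orthogonal_orthogonal]

omit [FiniteDimensional ℝ A] in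
theorem metricTrace_sphereHessian {ι : Type*} [Fintype ι] (g : sphere (0 : E) 1 → A)
    (x : sphere (0 : E) 1) (L : sphereTangent x →ₗ[ℝ] A) (v : Module.Basis ι ℝ (sphereTangent x))
    (hv : Orthonormal ℝ fun i => L (v i)) :
    metricTrace L (sphereHessian g x) = ∑ i, sphereHessian g x (v i) (v i) :=
  metricTrace_eq_sum L
    ((fderiv ℝ (fderiv ℝ (radialExt g)) (x : E)).toLinearMap₁₂.domRestrict₁₂
      (sphereTangent x) (sphereTangent x)) v hv

omit [FiniteDimensional ℝ E] [FiniteDimensional ℝ A] in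
theorem inner_sphereDeriv_of_unit {ψ : sphere (0 : E) 1 → A} (h1 : ∀ x, ‖ψ x‖ = 1)
    (x : sphere (0 : E) 1) (hd : DifferentiableAt ℝ (radialExt ψ) (x : E)) (u : sphereTangent x) :
    inner ℝ (ψ x) (sphereDeriv ψ x u) = 0 := by
  have := inner_fderiv_of_unit hd (by
    filter_upwards [isOpen_ne.mem_nhds (ne_zero_of_mem_unit_sphere x)] with z hz
    rw [radialExt_of_ne_zero _ hz, h1]) (u : E)
  simpa [sphereDeriv] using this

omit [FiniteDimensional ℝ E] [FiniteDimensional ℝ A] in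
theorem cone_homogeneous (ψ : sphere (0 : E) 1 → A) (r : ℝ) (hr : 0 < r) (y : E) :
    ‖r • y‖ • radialExt ψ (r • y) = r • (‖y‖ • radialExt ψ y) := by
  rw [radialExt_smul ψ hr, norm_smul, norm_of_nonneg hr.le, smul_smul]

/-- The cone over a minimal submanifold of the unit sphere is minimal. -/
theorem isMinimalImmersionOn_cone {ψ : sphere (0 : E) 1 → A}
    (hs : ∀ y : E, y ≠ 0 → ContDiffAt ℝ ∞ (radialExt ψ) y) (hψ : IsMinimalInUnitSphere ψ) :
    IsMinimalImmersionOn (fun y => ‖y‖ • radialExt ψ y) {0}ᶜ := by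
  set F : E → A := fun y => ‖y‖ • radialExt ψ y with hFdef
  have hF : ∀ y : E, y ≠ 0 → ContDiffAt ℝ ∞ F y := fun y hy => (contDiffAt_norm ℝ hy).smul (hs y hy)
  have hhom : ∀ r : ℝ, 0 < r → ∀ y, F (r • y) = r • F y := cone_homogeneous ψ
  refine ⟨fun y hy => (hF y hy).contDiffWithinAt, fun y hy => ?_⟩
  have hy0 : y ≠ 0 := hy
  set x := rayPoint y hy0 with hx
  set r := ‖y‖ with hr
  have hr0 : 0 < r := norm_pos_iff.2 hy0
  have hyx : y = r • (x : E) := (norm_smul_rayPoint y hy0).symm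
  have hx0 : (x : E) ≠ 0 := ne_zero_of_mem_unit_sphere x
  have h2 : (2 : WithTop ℕ∞) ≤ ∞ := WithTop.coe_le_coe.2 le_top
  have hg2 : ContDiffAt ℝ 2 (radialExt ψ) (x : E) := (hs _ hx0).of_le h2
  have hF2 : ContDiffAt ℝ 2 F (x : E) := (hF _ hx0).of_le h2
  -- The first derivative has degree 0 and the second degree -1, so the condition at `y` reduces to
  -- the unit vector `x`.
  have hDsmul : ∀ z, fderiv ℝ F (r • z) = fderiv ℝ F z := fun z => by
    rw [fderiv_smul_of_homogeneous hr0.ne' (hhom r hr0) z, inv_mul_cancel₀ hr0.ne', one_smul]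
  have hD : fderiv ℝ F y = fderiv ℝ F x := by rw [hyx, hDsmul]
  have hDD : fderiv ℝ (fderiv ℝ F) y = r⁻¹ • fderiv ℝ (fderiv ℝ F) x := by
    rw [hyx]
    simpa using fderiv_smul_of_homogeneous (c := 1) hr0.ne' (fun z => by rw [hDsmul, one_smul]) _
  rw [starProjection_orthogonal_eq_zero_iff, hD, hDD]
  set L := (fderiv ℝ F (x : E)).toLinearMap with hL
  have hLx : L (x : E) = ψ x := by
    have := fderiv_self_of_homogeneous hhom (hF2.differentiableAt (by norm_num))
    simpa [hL, hFdef] using this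
  have hLu : ∀ u : sphereTangent x, L (u : E) = sphereDeriv ψ x u :=
    fderiv_cone_apply_tangent (hg2.differentiableAt (by norm_num))
  obtain ⟨h1, hinj, htr⟩ := hψ x
  obtain ⟨v, hv⟩ := exists_basis_orthonormal_map _ hinj
  obtain ⟨b, hb, hb'⟩ := exists_basis_option x v
  have hortho := inner_sphereDeriv_of_unit (fun x => (hψ x).1) x
    (hg2.differentiableAt (by norm_num))
  have hLb : Orthonormal ℝ fun i => L (b i) := by
    classical
    rw [orthonormal_iff_ite]
    rintro (_ | i) (_ | j)
    · simp [hb, hLx, h1]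
    · simp [hb, hb', hLx, hLu, hortho]
    · simp [hb, hb', hLx, hLu, real_inner_comm, hortho]
    · simpa [hb', hLu] using orthonormal_iff_ite.1 hv i j
  refine ⟨injective_of_linearIndependent_map L b hLb.linearIndependent, ?_⟩
  have htrace : metricTrace L (fun u v => (r⁻¹ • fderiv ℝ (fderiv ℝ F) (x : E)) u v) =
      ∑ i, (r⁻¹ • fderiv ℝ (fderiv ℝ F) (x : E)) (b i) (b i) :=
    metricTrace_eq_sum L (r⁻¹ • fderiv ℝ (fderiv ℝ F) (x : E)).toLinearMap₁₂ b hLb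
  rw [htrace]
  rw [starProjection_orthogonal_eq_zero_iff, metricTrace_sphereHessian ψ x _ v hv] at htr
  have hψmem : ψ x ∈ L.range := ⟨x, hLx⟩
  have hle : (sphereDeriv ψ x).range ⊔ (ℝ ∙ ψ x) ≤ L.range := by
    refine sup_le ?_ ((Submodule.span_singleton_le_iff_mem _ _).2 hψmem)
    rintro _ ⟨u, rfl⟩
    exact ⟨u, hLu u⟩
  have hBx : fderiv ℝ (fderiv ℝ F) (x : E) x x = 0 := by
    rw [fderiv_fderiv_self_of_homogeneous hhom
      ((hF2.fderiv_right (m := 1) (by norm_num)).differentiableAt (by norm_num))]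
    rfl
  have hBu : ∀ i, ∃ c : ℝ, fderiv ℝ (fderiv ℝ F) (x : E) (v i) (v i) =
      c • ψ x + sphereHessian ψ x (v i) (v i) := fun i => exists_fderiv_fderiv_cone_eq hg2 (v i)
  choose c hc using hBu
  -- The radial term of the trace vanishes, the multiples of `ψ x` lie in the range of `L`, and what
  -- remains lies there because the link is minimal.
  simp only [smul_apply, ← Finset.smul_sum, Fintype.sum_option, hb, hb', hBx, hc, zero_add,
    Finset.sum_add_distrib]
  exact L.range.smul_mem _ (L.range.add_mem
    (L.range.sum_mem fun i _ => L.range.smul_mem _ hψmem) (hle htr))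

end Cone

/-! ### Spherical harmonics and the energy density of `f`. -/

section Harmonic

open MvPolynomial

theorem eval_smul_of_isHomogeneous {σ : Type*} [Fintype σ] {P : MvPolynomial σ ℝ} {k : ℕ}
    (hP : P.IsHomogeneous k) (r : ℝ) (y : σ → ℝ) : eval (r • y) P = r ^ k * eval y P := by
  rw [eval_eq', eval_eq', Finset.mul_sum]
  refine Finset.sum_congr rfl fun d hd => ?_
  have h1 : ∑ i, d i = k := by
    rw [← hP (mem_support_iff.1 hd)]
    simp [Finsupp.weight_apply, Finsupp.sum_fintype]
  simp only [Pi.smul_apply, smul_eq_mul, mul_pow, Finset.prod_mul_distrib, Finset.prod_pow_eq_pow_sum,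
    h1]
  ring

theorem hasFDerivAt_eval {d : ℕ} (P : MvPolynomial (Fin d) ℝ) (y : EuclideanSpace ℝ (Fin d)) :
    HasFDerivAt (fun y : EuclideanSpace ℝ (Fin d) => eval (fun j => y j) P)
      (∑ j, eval (fun j => y j) (pderiv j P) • EuclideanSpace.proj (𝕜 := ℝ) j) y := by
  induction P using MvPolynomial.induction_on with
  | C a => simpa using hasFDerivAt_const a y
  | add p q hp hq =>
    simp only [map_add, add_smul, Finset.sum_add_distrib]
    exact hp.fun_add hq
  | mul_X p i hp =>
    have h : HasFDerivAt (fun y : EuclideanSpace ℝ (Fin d) => eval (fun j => y j) (p * X i))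
        (eval (fun j => y j) p • (EuclideanSpace.proj i : EuclideanSpace ℝ (Fin d) →L[ℝ] ℝ) +
          y i • ∑ j, eval (fun j => y j) (pderiv j p) • EuclideanSpace.proj (𝕜 := ℝ) j) y := by
      simp only [map_mul, eval_X]
      exact hp.mul (EuclideanSpace.proj i : EuclideanSpace ℝ (Fin d) →L[ℝ] ℝ).hasFDerivAt
    refine h.congr_fderiv ?_
    ext u
    simp only [Derivation.leibniz, pderiv_X, Pi.single_apply, smul_eq_mul, map_add, map_mul, eval_X,
      add_smul, Finset.sum_add_distrib, mul_smul, Finset.smul_sum]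
    simp [apply_ite (eval _)]

theorem contDiff_eval {d : ℕ} (P : MvPolynomial (Fin d) ℝ) {k : WithTop ℕ∞} :
    ContDiff ℝ k (fun y : EuclideanSpace ℝ (Fin d) => eval (fun j => y j) P) := by
  induction P using MvPolynomial.induction_on with
  | C a => simpa using contDiff_const
  | add p q hp hq => simpa using hp.add hq
  | mul_X p i hp =>
    simpa using hp.mul (EuclideanSpace.proj i : EuclideanSpace ℝ (Fin d) →L[ℝ] ℝ).contDiff

theorem sum_pderiv_pderiv_sq {d : ℕ} {P : MvPolynomial (Fin d) ℝ} (hP : IsHarmonicPoly P) :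
    ∑ j, pderiv j (pderiv j (P ^ 2)) = 2 * ∑ j, pderiv j P ^ 2 := by
  have h : ∀ j, pderiv j (pderiv j (P ^ 2)) =
      2 * pderiv j P ^ 2 + 2 * P * pderiv j (pderiv j P) := fun j => by
    simp only [pow_two, Derivation.leibniz, smul_eq_mul, map_add]
    ring
  simp only [h, Finset.sum_add_distrib, ← Finset.mul_sum]
  rw [hP]
  ring

theorem eval_laplacian_normSq_pow {d : ℕ} (k : ℕ) (y : Fin d → ℝ)
    (hy : ∑ j, y j ^ 2 = 1) :
    eval y (∑ j, pderiv j (pderiv j ((∑ i, X i ^ 2 : MvPolynomial (Fin d) ℝ) ^ k))) =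
      2 * k * (2 * k + d - 2) := by
  set Q : MvPolynomial (Fin d) ℝ := ∑ i, X i ^ 2 with hQ
  have hQj : ∀ j, pderiv j Q = 2 * X j := fun j => by
    simp [hQ, Derivation.leibniz_pow, pderiv_X, Pi.single_apply]
  have hQ1 : eval y Q = 1 := by simp [hQ, hy]
  have h2 : ∀ j : Fin d, pderiv j (2 : MvPolynomial (Fin d) ℝ) = 0 := fun j => by
    simpa using (pderiv j).map_natCast 2
  have h : ∀ j, eval y (pderiv j (pderiv j (Q ^ k))) =
      4 * k * (k - 1) * y j ^ 2 + 2 * k := fun j => by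
    rcases k with _ | k
    · simp
    rcases k with _ | k
    · simp [hQj, Derivation.leibniz, h2]
    · simp [hQj, Derivation.leibniz, Derivation.leibniz_pow, h2, hQ1]
      ring
  rw [map_sum]
  simp only [h, Finset.sum_add_distrib, ← Finset.mul_sum, hy]
  simp
  ring

theorem exists_polynomials {n m p k : ℕ} {f : S n → S m} (hf : IsOfType f p k) :
    ∃ P : Fin (m + 1) → MvPolynomial (Fin (n + 1)) ℝ,
      (∀ i, (P i).IsHomogeneous k) ∧ (∀ i, IsHarmonicPoly (P i)) ∧
      ∀ x : S n, (f x : EuclideanSpace ℝ (Fin (m + 1))) =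
        WithLp.toLp 2 fun i => eval (fun j => (x : EuclideanSpace ℝ (Fin (n + 1))) j) (P i) := by
  choose P hP using hf.2
  exact ⟨P, fun i => (hP i).1, fun i => (hP i).2.1, fun x => by ext i; simp [(hP i).2.2 x]⟩

theorem contDiffAt_radialExt_of_isOfType {n m p k : ℕ} {f : S n → S m} (hf : IsOfType f p k)
    {r : WithTop ℕ∞} {y : EuclideanSpace ℝ (Fin (n + 1))} (hy : y ≠ 0) :
    ContDiffAt ℝ r (radialExt fun x => (f x : EuclideanSpace ℝ (Fin (m + 1)))) y := by
  obtain ⟨P, -, -, hP⟩ := exists_polynomials hf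
  refine contDiffAt_radialExt (G := fun y => WithLp.toLp 2 fun i => eval (fun j => y j) (P i))
    hP ?_ hy
  rw [contDiff_euclidean]
  exact fun i => contDiff_eval (P i)

/-- The energy density of a map whose components are spherical harmonics of degree `k`. -/
theorem sum_norm_sq_mapDeriv {n m p k : ℕ} {f : S n → S m} (hf : IsOfType f p k) (hk : k ≠ 0)
    (x : S n) {ι : Type*} [Fintype ι] (e : OrthonormalBasis ι ℝ (sphereTangent
      (x : sphere (0 : EuclideanSpace ℝ (Fin (n + 1))) 1))) :
    ∑ i, ‖mapDeriv f x (e i)‖ ^ 2 = (k : ℝ) * (k + n - 1) := by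
  obtain ⟨P, hhom, hharm, hP⟩ := exists_polynomials hf
  set G : EuclideanSpace ℝ (Fin (n + 1)) → EuclideanSpace ℝ (Fin (m + 1)) :=
    fun y => WithLp.toLp 2 fun i => eval (fun j => y j) (P i) with hG
  have hGd : ∀ y, HasFDerivAt G (fderiv ℝ G y) y := fun y =>
    ((contDiff_euclidean.2 fun i => contDiff_eval (P i) : ContDiff ℝ 1 G).differentiable
      (by norm_num) y).hasFDerivAt
  have hGu : ∀ y u i, fderiv ℝ G y u i = ∑ j, eval (fun j => y j) (pderiv j (P i)) * u j := by
    intro y u i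
    have h1 := ((EuclideanSpace.proj i : EuclideanSpace ℝ (Fin (m + 1)) →L[ℝ] ℝ).hasFDerivAt.comp y
      (hGd y)).unique (hasFDerivAt_eval (P i) y)
    simpa using DFunLike.congr_fun h1 u
  -- Both sides are homogeneous of degree `2k` and agree on the sphere, where `|f| = 1`, hence agree
  -- as polynomials. At the origin both vanish because `k ≠ 0`.
  have hsum : ∑ i, P i ^ 2 = (∑ j, X j ^ 2) ^ k := by
    refine MvPolynomial.funext fun y => ?_
    simp only [map_sum, map_pow, eval_X]
    by_cases hy : y = 0
    · have h0 : ∀ i, eval y (P i) = 0 := fun i => by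
        have := eval_smul_of_isHomogeneous (hhom i) 0 y
        simpa [hy, hk] using this
      simp only [h0]
      simp [hy, hk]
    · set z : EuclideanSpace ℝ (Fin (n + 1)) := WithLp.toLp 2 y with hz
      have hz0 : z ≠ 0 := by simpa [hz] using hy
      have hy' : y = ‖z‖ • fun j => (rayPoint z hz0 : EuclideanSpace ℝ (Fin (n + 1))) j := by
        have := congrArg WithLp.ofLp (norm_smul_rayPoint z hz0)
        simpa [hz] using this.symm
      have hnf : ‖(f (rayPoint z hz0) : EuclideanSpace ℝ (Fin (m + 1)))‖ ^ 2 = 1 := by simp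
      rw [hP, EuclideanSpace.real_norm_sq_eq] at hnf
      have hyz : ∑ j, y j ^ 2 = ‖z‖ ^ 2 := by rw [EuclideanSpace.real_norm_sq_eq]
      rw [hyz, hy']
      simp only [eval_smul_of_isHomogeneous (hhom _), mul_pow, ← Finset.mul_sum]
      rw [hnf, mul_one, ← pow_mul, ← pow_mul, mul_comm]
  have hxsq : ∑ j, (x : EuclideanSpace ℝ (Fin (n + 1))) j ^ 2 = 1 := by
    rw [← EuclideanSpace.real_norm_sq_eq]; simp
  -- Take the Laplacian of `hsum` at `x`: harmonicity leaves twice the squared gradient on the left.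
  have hgrad : ∑ j, ‖fderiv ℝ G x (EuclideanSpace.basisFun (Fin (n + 1)) ℝ j)‖ ^ 2 =
      k * (2 * k + n - 1) := by
    have h1 := eval_laplacian_normSq_pow k (fun j => (x : EuclideanSpace ℝ (Fin (n + 1))) j) hxsq
    rw [← hsum] at h1
    simp only [map_sum] at h1
    rw [Finset.sum_comm] at h1
    simp only [← map_sum, sum_pderiv_pderiv_sq (hharm _)] at h1
    simp only [map_sum, map_mul, map_pow, map_ofNat] at h1
    rw [← Finset.mul_sum, Finset.sum_comm] at h1
    have h2 : ∀ j i, fderiv ℝ G x (EuclideanSpace.basisFun (Fin (n + 1)) ℝ j) i =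
        eval (fun j => (x : EuclideanSpace ℝ (Fin (n + 1))) j) (pderiv j (P i)) := fun j i => by
      rw [hGu]
      simp
    simp only [EuclideanSpace.real_norm_sq_eq, h2]
    push_cast at h1
    linarith
  have hradial : fderiv ℝ G x x = (k : ℝ) • G x := by
    ext i
    rw [hGu]
    have := congrArg (eval fun j => (x : EuclideanSpace ℝ (Fin (n + 1))) j)
      (hhom i).sum_X_mul_pderiv
    simpa [hG, mul_comm] using this
  -- The full gradient has squared norm `k (2k + n - 1)`. By Euler the radial part contributes `k²`,
  -- and the rest is tangential.
  obtain ⟨b, hb, hb'⟩ := exists_orthonormalBasis_option x e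
  have h3 := sum_norm_sq_map_eq (fderiv ℝ G (x : EuclideanSpace ℝ (Fin (n + 1)))).toLinearMap
    b (EuclideanSpace.basisFun (Fin (n + 1)) ℝ)
  have hGx : ‖G x‖ = 1 := by rw [show G x = f x from (hP x).symm]; simp
  simp only [Fintype.sum_option, hb, hb', ContinuousLinearMap.coe_coe, hgrad, hradial,
    norm_smul, hGx] at h3
  have h4 : ∀ i, mapDeriv f x (e i) = fderiv ℝ G x (e i) := fun i =>
    sphereDeriv_eq_fderiv hP x (hGd _).differentiableAt (e i)
  simp only [h4]
  simp at h3
  linarith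

end Harmonic

/-! ### Traces in orthogonal frames and derivatives of pairs. -/

section SingularFrame

variable {A E : Type*}
  [NormedAddCommGroup A] [InnerProductSpace ℝ A]
  [NormedAddCommGroup E] [InnerProductSpace ℝ E] [FiniteDimensional ℝ E]

/-- Rescaling each `e i` by `1 / √(μ i)` gives a basis orthonormal for the pulled back metric. -/
theorem metricTrace_sphereHessian_of_orthogonal {ι : Type*} [Fintype ι] [DecidableEq ι]
    (g : sphere (0 : E) 1 → A) (x : sphere (0 : E) 1) (L : sphereTangent x →ₗ[ℝ] A)
    (e : Module.Basis ι ℝ (sphereTangent x)) {μ : ι → ℝ} (hμ : ∀ i, 0 < μ i)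
    (he : ∀ i j, inner ℝ (L (e i)) (L (e j)) = if i = j then μ i else 0) :
    metricTrace L (sphereHessian g x) = ∑ i, (μ i)⁻¹ • sphereHessian g x (e i) (e i) := by
  have hs : ∀ i, (√(μ i))⁻¹ ≠ 0 := fun i => inv_ne_zero (Real.sqrt_pos.2 (hμ i)).ne'
  have hv : ∀ i, e.unitsSMul (fun i => Units.mk0 _ (hs i)) i = (√(μ i))⁻¹ • e i := fun i => by
    rw [Module.Basis.unitsSMul_apply]; rfl
  have hsq : ∀ i, (√(μ i))⁻¹ * (√(μ i))⁻¹ = (μ i)⁻¹ := fun i => by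
    rw [← mul_inv, Real.mul_self_sqrt (hμ i).le]
  rw [metricTrace_sphereHessian g x L (e.unitsSMul fun i => Units.mk0 _ (hs i))]
  · refine Finset.sum_congr rfl fun i _ => ?_
    rw [hv, ← hsq]
    simp [sphereHessian, smul_smul]
  · rw [orthonormal_iff_ite]
    intro i j
    simp only [hv, map_smul, inner_smul_left, inner_smul_right, he]
    split_ifs with hij
    · subst hij
      simp only [conj_trivial]
      rw [← mul_assoc, hsq, inv_mul_cancel₀ (hμ i).ne']
    · simp

end SingularFrame

section Pairs

variable {A B E X : Type*}
  [NormedAddCommGroup A] [InnerProductSpace ℝ A] [NormedAddCommGroup B] [InnerProductSpace ℝ B]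
  [NormedAddCommGroup E] [InnerProductSpace ℝ E] [NormedAddCommGroup X] [NormedSpace ℝ X]

theorem fderiv_fderiv_clm_comp (l : A →L[ℝ] B) {h : E → A} {x : E} (hh : ContDiffAt ℝ 2 h x)
    (u v : E) :
    fderiv ℝ (fderiv ℝ fun y => l (h y)) x u v = l (fderiv ℝ (fderiv ℝ h) x u v) := by
  have h1 := hasFDerivAt_fderiv_apply (l.contDiff.contDiffAt.comp x hh : ContDiffAt ℝ 2 (l ∘ h) x) v
  have h2 := l.hasFDerivAt.comp x (hasFDerivAt_fderiv_apply hh v)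
  have h3 : (fun z => fderiv ℝ (l ∘ h) z v) =ᶠ[𝓝 x] l ∘ fun z => fderiv ℝ h z v := by
    filter_upwards [ContDiffAt.eventually_differentiableAt hh] with z hz
    rw [(l.hasFDerivAt.comp z hz.hasFDerivAt).fderiv]
    rfl
  exact DFunLike.congr_fun (h1.unique (h2.congr_of_eventuallyEq h3)) u

theorem fderiv_toLp_prod {g : X → A} {h : X → B} {y : X} {g' : X →L[ℝ] A} {h' : X →L[ℝ] B}
    (hg : HasFDerivAt g g' y) (hh : HasFDerivAt h h' y) (u : X) :
    fderiv ℝ (fun z => WithLp.toLp 2 (g z, h z)) y u = WithLp.toLp 2 (g' u, h' u) := by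
  have := (WithLp.prodContinuousLinearEquiv 2 ℝ A B).symm.hasFDerivAt.comp y (hg.prodMk hh)
  exact DFunLike.congr_fun this.fderiv u

theorem contDiffAt_toLp_prod {g : X → A} {h : X → B} {y : X} {r : WithTop ℕ∞}
    (hg : ContDiffAt ℝ r g y) (hh : ContDiffAt ℝ r h y) :
    ContDiffAt ℝ r (fun z => WithLp.toLp 2 (g z, h z)) y :=
  (WithLp.prodContinuousLinearEquiv 2 ℝ A B).symm.contDiff.contDiffAt.comp y (hg.prodMk hh)

end Pairs


/-! ### The singular frame, profile maps, the angle equation and the volume density. -/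

variable {n m p k : ℕ}

theorem finrank_sphereTangent (x : S n) :
    Module.finrank ℝ (sphereTangent (x : sphere (0 : EuclideanSpace ℝ (Fin (n + 1))) 1)) = n := by
  have h1 := (ℝ ∙ (x : EuclideanSpace ℝ (Fin (n + 1)))).finrank_add_finrank_orthogonal
  rw [finrank_span_singleton (ne_zero_of_mem_unit_sphere x), finrank_euclideanSpace,
    Fintype.card_fin] at h1
  change 1 + Module.finrank ℝ (sphereTangent (x : sphere _ 1)) = n + 1 at h1
  omega

/-- At each point there is an orthonormal frame in which the pulled back metric is diagonal, with
eigenvalue `k (k + n - 1) / p` of multiplicity `p` and all other eigenvalues zero. -/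
theorem exists_singular_frame {f : S n → S m} (hf : IsLOMSE f) (ht : IsOfType f p k) (hk : k ≠ 0)
    (hp : p ≠ 0) (x : S n) :
    p ≤ n ∧ ∃ e : OrthonormalBasis (Fin n) ℝ
      (sphereTangent (x : sphere (0 : EuclideanSpace ℝ (Fin (n + 1))) 1)),
      ∀ i j, inner ℝ (mapDeriv f x (e i)) (mapDeriv f x (e j)) =
        if i = j then (if (i : ℕ) < p then (k * (k + n - 1) / p : ℝ) else 0) else 0 := by
  have hd := finrank_sphereTangent x
  obtain ⟨e, he⟩ := exists_orthonormalBasis_singularValues (mapDeriv f x) hd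
  obtain ⟨l, hl⟩ := hf.2 x
  have hpn : p ≤ n :=
    (ht.1 x).symm.le.trans ((LinearMap.finrank_range_le _).trans hd.le)
  -- Singular values are listed in decreasing order, so rank `p` means that exactly the first `p`
  -- are nonzero.
  have hσ : ∀ i : ℕ, (mapDeriv f x).singularValues i ^ 2 = if i < p then l ^ 2 else 0 := by
    intro i
    split_ifs with hi
    · rw [hl i]
      rw [← ht.1 x] at hi
      exact ((mapDeriv f x).singularValues_pos_iff_lt_finrank_range.2 hi).ne'
    · rw [(mapDeriv f x).singularValues_eq_zero_iff_le_finrank_range.2 (by rw [ht.1 x]; omega)]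
      norm_num
  have hcard : (Finset.univ.filter fun i : Fin n => (i : ℕ) < p).card = p := by
    rw [Fin.card_filter_val_lt]; omega
  have hsum := sum_norm_sq_mapDeriv ht hk x e
  simp only [← real_inner_self_eq_norm_sq, he, if_true, hσ] at hsum
  rw [← Finset.sum_filter, Finset.sum_const, hcard, nsmul_eq_mul] at hsum
  have hp' : (p : ℝ) ≠ 0 := Nat.cast_ne_zero.2 hp
  have hl2 : l ^ 2 = k * (k + n - 1) / p := by
    rw [← hsum]; field_simp
  refine ⟨hpn, e, fun i j => ?_⟩
  rw [he, hσ, hl2]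

/-- The map `r x ↦ (a(r) x, b(r) f(x))`. -/
noncomputable def profileMap (f : S n → S m) (a b : ℝ → ℝ) (y : EuclideanSpace ℝ (Fin (n + 1))) :
    Ambient n m :=
  WithLp.toLp 2 (a ‖y‖ • radialExt (fun x : S n => (x : EuclideanSpace ℝ (Fin (n + 1)))) y,
    b ‖y‖ • radialExt (fun x => (f x : EuclideanSpace ℝ (Fin (m + 1)))) y)

theorem radialExt_losMap (f : S n → S m) (θ : ℝ) :
    radialExt (losMap f θ) = profileMap f (fun _ => cos θ) (fun _ => sin θ) := by
  ext1 y
  by_cases hy : y = 0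
  · simp [hy, radialExt, profileMap]
    rfl
  · rw [radialExt_of_ne_zero _ hy, profileMap, radialExt_of_ne_zero _ hy, radialExt_of_ne_zero _ hy]
    rfl

theorem coneMap_eq_profileMap (f : S n → S m) (θ : ℝ) :
    coneMap f θ = profileMap f (fun r => r * cos θ) (fun r => r * sin θ) := by
  ext1 y
  rw [coneMap, radialExt_losMap, profileMap, profileMap, ← WithLp.toLp_smul]
  simp [smul_smul]

theorem contDiffAt_radialExt_val {r : WithTop ℕ∞} {y : EuclideanSpace ℝ (Fin (n + 1))}
    (hy : y ≠ 0) :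
    ContDiffAt ℝ r (radialExt fun x : S n => (x : EuclideanSpace ℝ (Fin (n + 1)))) y :=
  contDiffAt_radialExt (G := id) (fun _ => rfl) contDiff_id hy

theorem sphereDeriv_val (x : S n)
    (u : sphereTangent (x : sphere (0 : EuclideanSpace ℝ (Fin (n + 1))) 1)) :
    sphereDeriv (fun x : S n => (x : EuclideanSpace ℝ (Fin (n + 1)))) x u = u := by
  exact (sphereDeriv_eq_fderiv (G := id) (fun _ => rfl) x differentiableAt_id u).trans (by simp)

theorem contDiffAt_profileMap {f : S n → S m} (hf : IsOfType f p k) {a b : ℝ → ℝ}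
    {r : WithTop ℕ∞} {y : EuclideanSpace ℝ (Fin (n + 1))} (hy : y ≠ 0)
    (ha : ContDiffAt ℝ r a ‖y‖) (hb : ContDiffAt ℝ r b ‖y‖) :
    ContDiffAt ℝ r (profileMap f a b) y := by
  have hN : ContDiffAt ℝ r (fun y : EuclideanSpace ℝ (Fin (n + 1)) => ‖y‖) y := contDiffAt_norm ℝ hy
  exact contDiffAt_toLp_prod ((ha.comp y hN).smul (contDiffAt_radialExt_val hy))
    ((hb.comp y hN).smul (contDiffAt_radialExt_of_isOfType hf hy))

theorem fderiv_norm_smul_coe (x : S n) {r : ℝ} (hr : 0 < r) :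
    fderiv ℝ (fun y : EuclideanSpace ℝ (Fin (n + 1)) => ‖y‖) (r • (x : EuclideanSpace ℝ (Fin (n + 1))))
      = fderiv ℝ (fun y : EuclideanSpace ℝ (Fin (n + 1)) => ‖y‖) x := by
  rw [fderiv_smul_of_homogeneous hr.ne' (c := r) (fun y => by simp [norm_smul, abs_of_pos hr]),
    inv_mul_cancel₀ hr.ne', one_smul]

/-- The radial direction sees only the profile `(a, b)`. Tangential derivatives of the ray-constant
factors scale by `1 / r`. -/
theorem fderiv_profileMap {f : S n → S m} (hf : IsOfType f p k) {a b : ℝ → ℝ} {a' b' r : ℝ}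
    (hr : 0 < r) (ha : HasDerivAt a a' r) (hb : HasDerivAt b b' r) (x : S n) :
    fderiv ℝ (profileMap f a b) (r • (x : EuclideanSpace ℝ (Fin (n + 1)))) x =
        WithLp.toLp 2 (a' • (x : EuclideanSpace ℝ (Fin (n + 1))),
          b' • (f x : EuclideanSpace ℝ (Fin (m + 1)))) ∧
      ∀ u : sphereTangent (x : sphere (0 : EuclideanSpace ℝ (Fin (n + 1))) 1),
        fderiv ℝ (profileMap f a b) (r • (x : EuclideanSpace ℝ (Fin (n + 1)))) u =
          WithLp.toLp 2 ((a r / r) • (u : EuclideanSpace ℝ (Fin (n + 1))),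
            (b r / r) • mapDeriv f x u) := by
  have hx0 : (x : EuclideanSpace ℝ (Fin (n + 1))) ≠ 0 := ne_zero_of_mem_unit_sphere x
  set y := r • (x : EuclideanSpace ℝ (Fin (n + 1))) with hy
  have hy0 : y ≠ 0 := smul_ne_zero hr.ne' hx0
  have hyr : ‖y‖ = r := by simp [hy, norm_smul, abs_of_pos hr]
  have hN : HasFDerivAt (fun y : EuclideanSpace ℝ (Fin (n + 1)) => ‖y‖)
      (fderiv ℝ (fun y : EuclideanSpace ℝ (Fin (n + 1)) => ‖y‖) x) y := by
    rw [← fderiv_norm_smul_coe x hr]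
    exact ((contDiffAt_norm ℝ hy0 (n := 1)).differentiableAt (by norm_num)).hasFDerivAt
  have hν := ((contDiffAt_radialExt_val hy0 (r := 1)).differentiableAt (by norm_num)).hasFDerivAt
  have hφ := ((contDiffAt_radialExt_of_isOfType hf hy0 (r := 1)).differentiableAt
    (by norm_num)).hasFDerivAt
  rw [← hyr] at ha hb
  have hD : ∀ w, fderiv ℝ (profileMap f a b) y w = _ := fun w =>
    fderiv_toLp_prod ((ha.comp_hasFDerivAt y hN).smul hν) ((hb.comp_hasFDerivAt y hN).smul hφ) w
  have hNx : fderiv ℝ (fun y : EuclideanSpace ℝ (Fin (n + 1)) => ‖y‖) x x = 1 := by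
    rw [fderiv_self_of_homogeneous (fun s hs z => by simp [norm_smul, abs_of_pos hs])
      ((contDiffAt_norm ℝ hx0 (n := 1)).differentiableAt (by norm_num))]
    simp
  have hνx : radialExt (fun x : S n => (x : EuclideanSpace ℝ (Fin (n + 1)))) y = x := by
    rw [hy, radialExt_smul _ hr, radialExt_coe]
  have hφx : radialExt (fun x => (f x : EuclideanSpace ℝ (Fin (m + 1)))) y = f x := by
    rw [hy, radialExt_smul _ hr, radialExt_coe]
  simp only [hD]
  have h1 := fderiv_radialExt_smul (fun x : S n => (x : EuclideanSpace ℝ (Fin (n + 1)))) hr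
    (x : EuclideanSpace ℝ (Fin (n + 1)))
  have h2 := fderiv_radialExt_smul (fun x => (f x : EuclideanSpace ℝ (Fin (m + 1)))) hr
    (x : EuclideanSpace ℝ (Fin (n + 1)))
  rw [← hy] at h1 h2
  have h3 := fderiv_radialExt_self
    ((contDiffAt_radialExt_val hx0 (r := 1)).differentiableAt (by norm_num))
  have h4 := fderiv_radialExt_self
    ((contDiffAt_radialExt_of_isOfType hf hx0 (r := 1)).differentiableAt (by norm_num))
  refine ⟨?_, fun u => ?_⟩
  · simp [hνx, hφx, h1, h2, h3, h4, hNx]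
  · have h5 : fderiv ℝ (radialExt fun x : S n => (x : EuclideanSpace ℝ (Fin (n + 1)))) x u = u :=
      sphereDeriv_val x u
    simp [hνx, hφx, h1, h2, h5, fderiv_norm_orthogonal x u (inner_sphereTangent x u), hyr,
      smul_smul, div_eq_mul_inv, mapDeriv, sphereDeriv]


variable {n m p k : ℕ}

/-- The Gram matrix of the images of the frame of `exists_singular_frame` under
`u ↦ (α u, β df(u))`. -/
theorem inner_toLp_frame {f : S n → S m} {x : S n} {Λ : ℝ}
    {e : OrthonormalBasis (Fin n) ℝ
      (sphereTangent (x : sphere (0 : EuclideanSpace ℝ (Fin (n + 1))) 1))}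
    (he : ∀ i j, inner ℝ (mapDeriv f x (e i)) (mapDeriv f x (e j)) =
        if i = j then (if (i : ℕ) < p then Λ else 0) else 0) (α β : ℝ) (i j : Fin n) :
    inner ℝ (WithLp.toLp 2 (α • (e i : EuclideanSpace ℝ (Fin (n + 1))), β • mapDeriv f x (e i)) :
        Ambient n m)
      (WithLp.toLp 2 (α • (e j : EuclideanSpace ℝ (Fin (n + 1))), β • mapDeriv f x (e j))) =
      if i = j then (if (i : ℕ) < p then α ^ 2 + β ^ 2 * Λ else α ^ 2) else 0 := by
  have h1 : inner ℝ (e i : EuclideanSpace ℝ (Fin (n + 1))) (e j : EuclideanSpace ℝ (Fin (n + 1))) =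
      if i = j then (1 : ℝ) else 0 := by
    rw [← Submodule.coe_inner]; exact orthonormal_iff_ite.1 e.orthonormal i j
  rw [WithLp.prod_inner_apply]
  simp only [inner_smul_left, inner_smul_right, conj_trivial]
  rw [h1, he]
  split_ifs <;> ring

/-- The equation that minimality imposes on the angle. -/
theorem angle_equation {f : S n → S m} {θ : ℝ} (hf : IsLOMSE f) (ht : IsOfType f p k) (hk : k ≠ 0)
    (hp : p ≠ 0) (hθ : IsLawsonOssermanSphere f θ) {Λ : ℝ} (hΛ : Λ = k * (k + n - 1) / p)
    (hΛ0 : 0 ≤ Λ) :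
    (n - p : ℝ) / cos θ ^ 2 + p * ((1 - Λ) / (cos θ ^ 2 + sin θ ^ 2 * Λ)) = 0 := by
  obtain ⟨⟨hθ0, hθ1⟩, hmin⟩ := hθ
  have hc : 0 < cos θ := cos_pos_of_mem_Ioo ⟨by linarith, hθ1⟩
  have hs : 0 < sin θ := sin_pos_of_pos_of_lt_pi hθ0 (by linarith [pi_pos])
  -- One point suffices, since `Λ` does not depend on the point.
  let x : S n := ⟨EuclideanSpace.single 0 1, by simp⟩
  have hx0 : (x : EuclideanSpace ℝ (Fin (n + 1))) ≠ 0 := ne_zero_of_mem_unit_sphere x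
  obtain ⟨hpn, e, he⟩ := exists_singular_frame hf ht hk hp x
  rw [← hΛ] at he
  obtain ⟨-, -, htr⟩ := hmin x
  have hD : ∀ u, sphereDeriv (losMap f θ) x u =
      WithLp.toLp 2 (cos θ • (u : EuclideanSpace ℝ (Fin (n + 1))), sin θ • mapDeriv f x u) := by
    intro u
    have := (fderiv_profileMap ht one_pos (hasDerivAt_const (1 : ℝ) (cos θ))
      (hasDerivAt_const (1 : ℝ) (sin θ)) x).2 u
    rw [one_smul, div_one, div_one, ← radialExt_losMap] at this
    exact this
  set μ : Fin n → ℝ := fun i => if (i : ℕ) < p then cos θ ^ 2 + sin θ ^ 2 * Λ else cos θ ^ 2 with hμ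
  have hμ0 : ∀ i, 0 < μ i := fun i => by simp only [hμ]; split_ifs <;> positivity
  rw [starProjection_orthogonal_eq_zero_iff, metricTrace_sphereHessian_of_orthogonal _ _ _ e.toBasis
    hμ0 (fun i j => by
      rw [hD, hD, OrthonormalBasis.coe_toBasis]; exact inner_toLp_frame he _ _ i j)] at htr
  -- `N` is tangent to the ambient sphere and normal to the image; only this component of the mean
  -- curvature is used.
  set N : Ambient n m := WithLp.toLp 2 (-sin θ • (x : EuclideanSpace ℝ (Fin (n + 1))),
    cos θ • (f x : EuclideanSpace ℝ (Fin (m + 1)))) with hN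
  have hν2 := contDiffAt_radialExt_val (r := 2) hx0
  have hφ2 := contDiffAt_radialExt_of_isOfType (r := 2) ht hx0
  have hν1 : ∀ᶠ z in 𝓝 (x : EuclideanSpace ℝ (Fin (n + 1))),
      ‖radialExt (fun x : S n => (x : EuclideanSpace ℝ (Fin (n + 1)))) z‖ = 1 := by
    filter_upwards [isOpen_ne.mem_nhds hx0] with z hz
    rw [radialExt_of_ne_zero _ hz]; simp
  have hφ1 : ∀ᶠ z in 𝓝 (x : EuclideanSpace ℝ (Fin (n + 1))),
      ‖radialExt (fun x => (f x : EuclideanSpace ℝ (Fin (m + 1)))) z‖ = 1 := by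
    filter_upwards [isOpen_ne.mem_nhds hx0] with z hz
    rw [radialExt_of_ne_zero _ hz]; simp
  have hperp : (sphereDeriv (losMap f θ) x).range ⊔ (ℝ ∙ losMap f θ x) ≤ (ℝ ∙ N)ᗮ := by
    refine sup_le ?_ ((Submodule.span_singleton_le_iff_mem _ _).2 ?_)
    · rintro _ ⟨u, rfl⟩
      have h2 := inner_sphereDeriv_of_unit (ψ := fun x => (f x : EuclideanSpace ℝ (Fin (m + 1))))
        (fun x => by simp) x (hφ2.differentiableAt (by norm_num)) u
      rw [Submodule.mem_orthogonal_singleton_iff_inner_right, hD, WithLp.prod_inner_apply]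
      simp only [hN, inner_smul_left, inner_smul_right, inner_sphereTangent x u]
      rw [show inner ℝ (f x : EuclideanSpace ℝ (Fin (m + 1))) (mapDeriv f x u) = 0 from h2]
      simp
    · rw [Submodule.mem_orthogonal_singleton_iff_inner_right, losMap, WithLp.prod_inner_apply]
      simp [hN, inner_smul_left, inner_smul_right]
      ring
  have hHess : ∀ u, inner ℝ N (sphereHessian (losMap f θ) x u u) =
      sin θ * cos θ * (inner ℝ (u : EuclideanSpace ℝ (Fin (n + 1)))
        (u : EuclideanSpace ℝ (Fin (n + 1))) - inner ℝ (mapDeriv f x u) (mapDeriv f x u)) := by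
    intro u
    have hψ2 : ContDiffAt ℝ 2 (radialExt (losMap f θ)) (x : EuclideanSpace ℝ (Fin (n + 1))) := by
      rw [radialExt_losMap]
      exact contDiffAt_profileMap ht hx0 contDiffAt_const contDiffAt_const
    have h1 := fderiv_fderiv_clm_comp (WithLp.fstL 2 ℝ (EuclideanSpace ℝ (Fin (n + 1)))
      (EuclideanSpace ℝ (Fin (m + 1)))) hψ2 u u
    have h2 := fderiv_fderiv_clm_comp (WithLp.sndL 2 ℝ (EuclideanSpace ℝ (Fin (n + 1)))
      (EuclideanSpace ℝ (Fin (m + 1)))) hψ2 u u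
    have h3 := fderiv_fderiv_clm_comp
      (cos θ • ContinuousLinearMap.id ℝ (EuclideanSpace ℝ (Fin (n + 1)))) hν2 u u
    have h4 := fderiv_fderiv_clm_comp
      (sin θ • ContinuousLinearMap.id ℝ (EuclideanSpace ℝ (Fin (m + 1)))) hφ2 u u
    rw [radialExt_losMap] at h1 h2
    have h5 := h1.symm.trans h3
    have h6 := h2.symm.trans h4
    have h7 := inner_fderiv_fderiv_of_unit hν2 hν1 u
    have h8 := inner_fderiv_fderiv_of_unit hφ2 hφ1 u
    rw [← radialExt_losMap] at h5 h6
    have h9 : fderiv ℝ (radialExt fun x : S n => (x : EuclideanSpace ℝ (Fin (n + 1)))) x u = u :=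
      sphereDeriv_val x u
    rw [radialExt_coe, h9] at h7
    rw [radialExt_coe] at h8
    rw [WithLp.prod_inner_apply]
    change inner ℝ (-sin θ • (x : EuclideanSpace ℝ (Fin (n + 1))))
      (WithLp.fstL 2 ℝ _ _ (sphereHessian (losMap f θ) x u u)) +
      inner ℝ (cos θ • (f x : EuclideanSpace ℝ (Fin (m + 1))))
      (WithLp.sndL 2 ℝ _ _ (sphereHessian (losMap f θ) x u u)) = _
    rw [sphereHessian, h5, h6]
    simp only [smul_apply, ContinuousLinearMap.id_apply, inner_smul_left, inner_smul_right, h7, h8,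
      real_inner_self_eq_norm_sq, conj_trivial]
    simp only [mapDeriv, sphereDeriv, LinearMap.comp_apply, Submodule.subtype_apply,
      ContinuousLinearMap.coe_coe]
    ring
  have h0 := Submodule.mem_orthogonal_singleton_iff_inner_right.1 (hperp htr)
  have hee : ∀ i, inner ℝ (e i : EuclideanSpace ℝ (Fin (n + 1)))
      (e i : EuclideanSpace ℝ (Fin (n + 1))) = (1 : ℝ) := fun i => by
    rw [← Submodule.coe_inner]; simp
  have hterm : ∀ i : Fin n, (μ i)⁻¹ * (sin θ * cos θ * (1 - if (i : ℕ) < p then Λ else 0)) =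
      sin θ * cos θ * (if (i : ℕ) < p then (1 - Λ) / (cos θ ^ 2 + sin θ ^ 2 * Λ)
        else 1 / cos θ ^ 2) := fun i => by
    simp only [hμ]
    split_ifs <;> ring
  simp only [inner_sum, inner_smul_right, OrthonormalBasis.coe_toBasis, hHess, hee, he, if_true,
    hterm] at h0
  rw [← Finset.mul_sum, Finset.sum_ite, Finset.sum_const, Finset.sum_const, Finset.filter_not,
    Finset.card_sdiff_of_subset (Finset.filter_subset _ _), Fin.card_filter_val_lt,
    min_eq_right hpn, Finset.card_univ, Fintype.card_fin, nsmul_eq_mul, nsmul_eq_mul,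
    Nat.cast_sub hpn] at h0
  have := (mul_eq_zero.1 h0).resolve_left (mul_pos hs hc).ne'
  rw [← this]
  ring

/-- The volume density of `r x ↦ (a(r) x, b(r) f(x))`. -/
theorem normDet_profileMap {f : S n → S m} (hf : IsLOMSE f) (ht : IsOfType f p k) (hk : k ≠ 0)
    (hp : p ≠ 0) {Λ : ℝ} (hΛ : Λ = k * (k + n - 1) / p) {a b : ℝ → ℝ} {a' b' : ℝ}
    {y : EuclideanSpace ℝ (Fin (n + 1))} (hy : y ≠ 0) (ha : HasDerivAt a a' ‖y‖)
    (hb : HasDerivAt b b' ‖y‖) :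
    (fderiv ℝ (profileMap f a b) y).toLinearMap.normDet =
      √(a' ^ 2 + b' ^ 2) * (√((a ‖y‖ / ‖y‖) ^ 2) ^ (n - p) *
        √((a ‖y‖ / ‖y‖) ^ 2 + (b ‖y‖ / ‖y‖) ^ 2 * Λ) ^ p) := by
  set x : S n := rayPoint y hy with hx
  obtain ⟨hpn, e, he⟩ := exists_singular_frame hf ht hk hp x
  rw [← hΛ] at he
  obtain ⟨hDx, hDu⟩ := fderiv_profileMap ht (norm_pos_iff.2 hy) ha hb x
  rw [hx, norm_smul_rayPoint] at hDx hDu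
  rw [← hx] at hDx hDu
  obtain ⟨B, hB, hB'⟩ := exists_orthonormalBasis_option x e
  have hortho := inner_sphereDeriv_of_unit (ψ := fun x => (f x : EuclideanSpace ℝ (Fin (m + 1))))
    (fun x => by simp) x ((contDiffAt_radialExt_of_isOfType (r := 1) ht
      (ne_zero_of_mem_unit_sphere x)).differentiableAt (by norm_num))
  have hcross : ∀ i, inner ℝ (fderiv ℝ (profileMap f a b) y x)
      (fderiv ℝ (profileMap f a b) y (e i : EuclideanSpace ℝ (Fin (n + 1)))) = 0 := fun i => by
    rw [hDx, hDu, WithLp.prod_inner_apply]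
    simp only [inner_smul_left, inner_smul_right, inner_sphereTangent x (e i)]
    rw [show inner ℝ (f x : EuclideanSpace ℝ (Fin (m + 1))) (mapDeriv f x (e i)) = 0
      from hortho _]
    simp
  have hin := inner_toLp_frame he (a ‖y‖ / ‖y‖) (b ‖y‖ / ‖y‖)
  have hnx : ‖fderiv ℝ (profileMap f a b) y x‖ = √(a' ^ 2 + b' ^ 2) := by
    rw [hDx, norm_eq_sqrt_real_inner, WithLp.prod_inner_apply]
    simp [norm_smul, pow_two]
  have hnu : ∀ i : Fin n, ‖fderiv ℝ (profileMap f a b) y (e i : EuclideanSpace ℝ (Fin (n + 1)))‖ =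
      if (i : ℕ) < p then √((a ‖y‖ / ‖y‖) ^ 2 + (b ‖y‖ / ‖y‖) ^ 2 * Λ)
        else √((a ‖y‖ / ‖y‖) ^ 2) := fun i => by
    rw [hDu, norm_eq_sqrt_real_inner, hin, if_pos rfl]
    split_ifs <;> rfl
  rw [normDet_eq_prod_norm _ B]
  · simp only [Fintype.prod_option, hB, hB', ContinuousLinearMap.coe_coe, hnx, hnu]
    rw [Finset.prod_ite, Finset.prod_const, Finset.prod_const, Finset.filter_not,
      Finset.card_sdiff_of_subset (Finset.filter_subset _ _), Fin.card_filter_val_lt,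
      min_eq_right hpn, Finset.card_univ, Fintype.card_fin]
    ring
  · rintro (_ | i) (_ | j) hij
    · exact absurd rfl hij
    · simpa only [hB, hB', ContinuousLinearMap.coe_coe] using hcross j
    · simpa only [hB, hB', ContinuousLinearMap.coe_coe, real_inner_comm] using hcross i
    · have : i ≠ j := fun h => hij (by rw [h])
      simp only [hB', ContinuousLinearMap.coe_coe]
      rw [hDu, hDu, hin, if_neg this]


/-! ### Differentiating the volume twice under the integral sign. -/

section SecondVariation

variable {E P : Type*} [NormedAddCommGroup E] [MeasurableSpace E] [BorelSpace E]
  [NormedAddCommGroup P] [NormedSpace ℝ P] (μ : Measure E) [IsFiniteMeasureOnCompacts μ]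

theorem hasDerivAt_fst_of_differentiable {G : ℝ × P → ℝ} (hG : Differentiable ℝ G) (t : ℝ)
    (z : P) : HasDerivAt (fun s => G (s, z)) (fderiv ℝ G (t, z) (1, 0)) t :=
  (hG (t, z)).hasFDerivAt.comp_hasDerivAt (f := fun s => (s, z)) t
    ((hasDerivAt_id t).prodMk (hasDerivAt_const t z))

/-- All dependence on `y` passes through `γ`, so the derivative is bounded on the compact set `[t -
1, t + 1] × γ(K)` and dominated convergence applies. -/
theorem hasDerivAt_setIntegral_of_contDiff {G : ℝ × P → ℝ} (hG : ContDiff ℝ 1 G) {γ : E → P}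
    {K : Set E} (hK : IsCompact K) (hγ : ContinuousOn γ K) (t : ℝ) :
    HasDerivAt (fun t => ∫ y in K, G (t, γ y) ∂μ)
      (∫ y in K, fderiv ℝ G (t, γ y) (1, 0) ∂μ) t := by
  have hG' : Continuous fun q => fderiv ℝ G q (1, 0) :=
    (hG.continuous_fderiv (by norm_num)).clm_apply continuous_const
  have hcont : ∀ {H : ℝ × P → ℝ}, Continuous H → ∀ s, ContinuousOn (fun y => H (s, γ y)) K :=
    fun hH s => hH.comp_continuousOn (continuousOn_const.prodMk hγ)
  have hKm : MeasurableSet K := hK.measurableSet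
  obtain ⟨C, hC⟩ := ((isCompact_Icc (a := t - 1) (b := t + 1)).prod
    (hK.image_of_continuousOn hγ)).exists_bound_of_continuousOn hG'.continuousOn
  have hnhds : Icc (t - 1) (t + 1) ∈ 𝓝 t := Icc_mem_nhds (by linarith) (by linarith)
  refine (hasDerivAt_integral_of_dominated_loc_of_deriv_le (bound := fun _ => C) hnhds
    (Eventually.of_forall fun s => (hcont hG.continuous s).aestronglyMeasurable hKm)
    ((hcont hG.continuous t).integrableOn_compact hK)
    ((hcont hG' t).aestronglyMeasurable hKm)
    ((ae_restrict_iff' hKm).2 (Eventually.of_forall fun y hy s hs =>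
      hC (s, γ y) ⟨hs, mem_image_of_mem γ hy⟩))
    (continuousOn_const.integrableOn_compact hK)
    (Eventually.of_forall fun y s _ =>
      hasDerivAt_fst_of_differentiable (hG.differentiable (by norm_num)) s (γ y))).2

/-- The second derivative at zero of an integral of the form
`∫ √(1 + t² α²) W(t β)`. -/
theorem second_variation {W W' : ℝ → ℝ} {W₂ : ℝ} (hW : ContDiff ℝ 2 W)
    (hW1 : ∀ s, HasDerivAt W (W' s) s) (hW2 : HasDerivAt W' W₂ 0) {α β : E → ℝ} {K : Set E}
    (hK : IsCompact K) (hα : ContinuousOn α K) (hβ : ContinuousOn β K) :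
    ∃ V' : ℝ → ℝ,
      (∀ t, HasDerivAt (fun t => ∫ y in K, √(1 + (t * α y) ^ 2) * W (t * β y) ∂μ) (V' t) t) ∧
      HasDerivAt V' (∫ y in K, (W 0 * α y ^ 2 + W₂ * β y ^ 2) ∂μ) 0 := by
  set G : ℝ × ℝ × ℝ → ℝ := fun q => √(1 + (q.1 * q.2.1) ^ 2) * W (q.1 * q.2.2) with hGdef
  have hG : ContDiff ℝ 2 G := by
    refine ContDiff.mul (ContDiff.sqrt ?_ fun q => by positivity) (hW.comp ?_)
    · fun_prop
    · fun_prop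
  set G' : ℝ × ℝ × ℝ → ℝ := fun q => fderiv ℝ G q (1, 0) with hG'def
  have hG' : ContDiff ℝ 1 G' := (hG.fderiv_right (m := 1) (by norm_num)).clm_apply contDiff_const
  have hγ : ContinuousOn (fun y => (α y, β y)) K := hα.prodMk hβ
  refine ⟨fun t => ∫ y in K, G' (t, α y, β y) ∂μ, fun t =>
    hasDerivAt_setIntegral_of_contDiff μ (hG.of_le (by norm_num)) hK hγ t, ?_⟩
  have h2 := hasDerivAt_setIntegral_of_contDiff μ hG' hK hγ 0
  have hsq : ∀ t a : ℝ, 0 < 1 + (t * a) ^ 2 := fun t a => by positivity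
  have hD1 : ∀ t a b : ℝ, G' (t, a, b) =
      t * a ^ 2 / √(1 + (t * a) ^ 2) * W (t * b) + √(1 + (t * a) ^ 2) * (W' (t * b) * b) := by
    intro t a b
    have h1 : HasDerivAt (fun s => G (s, a, b)) (G' (t, a, b)) t :=
      hasDerivAt_fst_of_differentiable (hG.differentiable (by norm_num)) t (a, b)
    have h3 : HasDerivAt (fun s : ℝ => 1 + (s * a) ^ 2) (2 * (t * a) * a) t := by
      simpa using (((hasDerivAt_id t).mul_const a).pow 2).const_add 1
    have h4 : HasDerivAt (fun s : ℝ => W (s * b)) (W' (t * b) * b) t :=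
      (hW1 (t * b)).comp t (by simpa using (hasDerivAt_id t).mul_const b)
    have h5 := (h3.sqrt (hsq t a).ne').mul h4
    rw [h1.unique h5]
    have := (Real.sqrt_pos.2 (hsq t a)).ne'
    field_simp
  -- The square root has zero derivative at `t = 0`, so no mixed term and no first derivative of `W`
  -- survive.
  have hD2 : ∀ a b : ℝ, fderiv ℝ G' (0, a, b) (1, 0) = W 0 * a ^ 2 + W₂ * b ^ 2 := by
    intro a b
    have h1 : HasDerivAt (fun s => G' (s, a, b)) (fderiv ℝ G' (0, a, b) (1, 0)) 0 :=
      hasDerivAt_fst_of_differentiable (hG'.differentiable (by norm_num)) 0 (a, b)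
    have h3 : HasDerivAt (fun s : ℝ => 1 + (s * a) ^ 2) (2 * (0 * a) * a) 0 := by
      simpa using (((hasDerivAt_id (0 : ℝ)).mul_const a).pow 2).const_add 1
    have h3' := h3.sqrt (hsq 0 a).ne'
    have h4 : HasDerivAt (fun s : ℝ => W (s * b)) (W' (0 * b) * b) 0 :=
      (hW1 (0 * b)).comp (0 : ℝ) (by simpa using (hasDerivAt_id (0 : ℝ)).mul_const b)
    have h5 : HasDerivAt (fun s : ℝ => W' (s * b)) (W₂ * b) 0 := by
      have hz : HasDerivAt W' W₂ (0 * b) := by rwa [zero_mul]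
      exact hz.comp (0 : ℝ) (by simpa using (hasDerivAt_id (0 : ℝ)).mul_const b)
    have h6 : HasDerivAt (fun s : ℝ => s * a ^ 2) (a ^ 2) 0 := by
      simpa using (hasDerivAt_id (0 : ℝ)).mul_const (a ^ 2)
    have h7 := (((h6.div h3' (Real.sqrt_pos.2 (hsq 0 a)).ne').mul h4).add
      (h3'.mul (h5.mul_const b)))
    have h8 := h1.unique (h7.congr_of_eventuallyEq (Eventually.of_forall fun s => hD1 s a b))
    rw [h8]
    simp
    ring
  simpa only [hD2] using h2

end SecondVariation

/-! ### Sharpness of Hardy's inequality: the radial test function. -/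

section TestFunction

/-- If `w₂ + q² w < 0`, then the quadratic form `∫ (w (η' - q η)² + w₂ η²)` is negative at
`η(s) = χ(s / l)` for some `l > 0`. -/
theorem exists_scale_integral_neg {q w w₂ : ℝ} (hw : 0 < w) (h : w₂ + q ^ 2 * w < 0)
    (χ : ContDiffBump (0 : ℝ)) :
    ∃ l : ℝ, 0 < l ∧
      ∫ s, (w * (deriv χ (s / l) / l - q * χ (s / l)) ^ 2 + w₂ * χ (s / l) ^ 2) < 0 := by
  have hχ : ContDiff ℝ 1 χ := χ.contDiff
  have hχd : ∀ s, HasDerivAt χ (deriv χ s) s := fun s =>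
    (hχ.differentiable (by norm_num) s).hasDerivAt
  have hc : Continuous χ := hχ.continuous
  have hc' : Continuous (deriv χ) := hχ.continuous_deriv (by norm_num)
  have hs : HasCompactSupport χ := χ.hasCompactSupport
  have hs' : HasCompactSupport (deriv χ) := hs.deriv
  have hi1 : Integrable fun s => deriv χ s ^ 2 := by
    simp only [pow_two]
    exact (hc'.mul hc').integrable_of_hasCompactSupport hs'.mul_right
  have hi2 : Integrable fun s => χ s * deriv χ s :=
    (hc.mul hc').integrable_of_hasCompactSupport hs.mul_right
  have hi3 : Integrable fun s => χ s ^ 2 := by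
    simp only [pow_two]
    exact (hc.mul hc).integrable_of_hasCompactSupport hs.mul_right
  -- The cross term in the expanded square is a multiple of `(χ²)'`.
  have h0 : ∫ s, χ s * deriv χ s = 0 := by
    have hd : ∀ s, HasDerivAt (fun s => χ s ^ 2) (2 * (χ s * deriv χ s)) s := fun s => by
      have := (hχd s).pow 2
      simp only [Nat.cast_ofNat, Nat.add_one_sub_one, pow_one] at this
      rwa [mul_assoc] at this
    have := integral_eq_zero_of_hasDerivAt_of_integrable hd (hi2.const_mul 2) hi3
    rw [integral_const_mul] at this
    linarith
  set A := ∫ s, deriv χ s ^ 2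
  set B := ∫ s, χ s ^ 2 with hB
  have hA : 0 ≤ A := integral_nonneg fun s => sq_nonneg _
  have hBpos : 0 < B := by
    rw [hB, integral_pos_iff_support_of_nonneg (fun s => sq_nonneg _) hi3]
    have : Function.support (fun s => χ s ^ 2) = ball 0 χ.rOut := by
      rw [← χ.support_eq]; ext s; simp
    rw [this]
    exact measure_ball_pos _ _ χ.rOut_pos
  -- Stretching by `l` damps the gradient term by `1 / l²`, which is at most `1 / l` as `l > 1`. The
  -- second bound makes `w A / l` smaller than the negative zeroth order term.
  obtain ⟨l, hl⟩ := exists_gt (max 1 (w * A / (-(w₂ + q ^ 2 * w) * B)))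
  have hl1 : 1 < l := (le_max_left _ _).trans_lt hl
  have hl0 : 0 < l := by linarith
  have hlA : w * A < l * (-(w₂ + q ^ 2 * w) * B) :=
    (div_lt_iff₀ (mul_pos (by linarith) hBpos)).1 ((le_max_right _ _).trans_lt hl)
  refine ⟨l, hl0, ?_⟩
  rw [Measure.integral_comp_div (fun s => w * (deriv χ s / l - q * χ s) ^ 2 + w₂ * χ s ^ 2) l]
  have hexp : ∀ s, w * (deriv χ s / l - q * χ s) ^ 2 + w₂ * χ s ^ 2 =
      w / l ^ 2 * deriv χ s ^ 2 + (-(2 * w * q / l)) * (χ s * deriv χ s) +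
        (w₂ + q ^ 2 * w) * χ s ^ 2 := fun s => by
    field_simp
    ring
  simp only [hexp]
  have hi12 : Integrable fun s => w / l ^ 2 * deriv χ s ^ 2 +
      (-(2 * w * q / l)) * (χ s * deriv χ s) := (hi1.const_mul _).add (hi2.const_mul _)
  rw [integral_add hi12 (hi3.const_mul _),
    integral_add (hi1.const_mul _) (hi2.const_mul _), integral_const_mul, integral_const_mul,
    integral_const_mul, h0, mul_zero, add_zero, smul_eq_mul]
  refine mul_neg_of_pos_of_neg (abs_pos.2 hl0.ne') ?_
  have h1 : w / l ^ 2 * A ≤ w * A / l := by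
    rw [div_mul_eq_mul_div]
    exact div_le_div_of_nonneg_left (by positivity) hl0 (by nlinarith)
  have h2 : w * A / l < -(w₂ + q ^ 2 * w) * B := by
    rw [div_lt_iff₀ hl0]; linarith
  change w / l ^ 2 * A + (w₂ + q ^ 2 * w) * B < 0
  linarith

theorem integral_Ioi_inv_mul_comp_log (J : ℝ → ℝ) :
    ∫ r in Ioi (0 : ℝ), r⁻¹ * J (log r) = ∫ s, J s := by
  have h := integral_image_eq_integral_abs_deriv_smul (f := exp) (f' := exp) MeasurableSet.univ
    (fun x _ => (Real.hasDerivAt_exp x).hasDerivWithinAt) Real.exp_injective.injOn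
    (fun r => r⁻¹ * J (log r))
  rw [image_univ, Real.range_exp] at h
  rw [h, Measure.restrict_univ]
  refine integral_congr_ae (Eventually.of_forall fun s => ?_)
  simp [abs_of_pos (exp_pos s)]

end TestFunction

/-- A radial test function at which the quadratic form `∫ (w φ'² + w₂ φ² / r²)` on `ℝⁿ⁺¹`,
`n = 2 q + 1`, is negative. -/
theorem exists_test_function {n q : ℕ} (hn : n = 2 * q + 1) (hq : q ≠ 0) {w w₂ : ℝ} (hw : 0 < w)
    (h : w₂ + (q : ℝ) ^ 2 * w < 0) :
    ∃ (φ : ℝ → ℝ) (a b : ℝ), 0 < a ∧ (∀ r, 0 < r → ContDiffAt ℝ ∞ φ r) ∧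
      (∀ r, 0 < r → r ∉ Icc a b → φ r = 0) ∧
      ∫ y in {y : EuclideanSpace ℝ (Fin (n + 1)) | ‖y‖ ∈ Icc a b},
        (w * deriv φ ‖y‖ ^ 2 + w₂ * (φ ‖y‖ / ‖y‖) ^ 2) < 0 := by
  let χ : ContDiffBump (0 : ℝ) := ⟨1, 2, one_pos, one_lt_two⟩
  obtain ⟨l, hl, hneg⟩ := exists_scale_integral_neg hw h χ
  have hsupp : ∀ s, s ∉ Icc (-2 : ℝ) 2 → χ s = 0 ∧ deriv χ s = 0 := by
    intro s hs
    have hs' : s ∉ tsupport χ := by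
      rw [χ.tsupport_eq, Real.closedBall_eq_Icc]
      simpa [χ] using hs
    exact ⟨image_eq_zero_of_notMem_tsupport hs',
      image_eq_zero_of_notMem_tsupport fun h => hs' (tsupport_deriv_subset (𝕜 := ℝ) h)⟩
  -- `r^{-q}` is the borderline power for Hardy's inequality when `n = 2q + 1`. With a cutoff in `s
  -- = log r` the weight `rⁿ dr` turns the form into one on the line with constant coefficients.
  set φ : ℝ → ℝ := fun r => (r ^ q)⁻¹ * χ (log r / l) with hφ
  have hout : ∀ r, 0 < r → r ∉ Icc (exp (-2 * l)) (exp (2 * l)) → log r / l ∉ Icc (-2 : ℝ) 2 := by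
    intro r hr hr' hs
    refine hr' ⟨?_, ?_⟩
    · rw [← Real.le_log_iff_exp_le hr]; exact (le_div_iff₀ hl).1 hs.1
    · rw [← Real.log_le_iff_le_exp hr]; exact (div_le_iff₀ hl).1 hs.2
  have hd : ∀ r, 0 < r → deriv φ r =
      (r ^ (q + 1))⁻¹ * (deriv χ (log r / l) / l - q * χ (log r / l)) := by
    intro r hr
    have h1 := (hasDerivAt_pow q r).inv (pow_ne_zero q hr.ne')
    have h2 : HasDerivAt (fun r => χ (log r / l)) (deriv χ (log r / l) * (r⁻¹ / l)) r :=
      ((χ.contDiff (n := 1)).differentiable (by norm_num) _).hasDerivAt.comp r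
        ((Real.hasDerivAt_log hr.ne').div_const l)
    have h3 : HasDerivAt φ _ r := h1.mul h2
    rw [h3.deriv]
    -- Writing `q = j + 1` removes the truncated exponent `q - 1` from the derivative of `r ^ q`.
    obtain ⟨j, rfl⟩ := Nat.exists_eq_succ_of_ne_zero hq
    simp only [Pi.inv_apply, Nat.succ_eq_add_one, Nat.add_sub_cancel]
    field_simp
    ring
  refine ⟨φ, exp (-2 * l), exp (2 * l), exp_pos _, fun r hr => ?_, fun r hr hr' => ?_, ?_⟩
  · exact ((contDiffAt_id.pow q).inv (pow_ne_zero q hr.ne')).mul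
      (χ.contDiff.contDiffAt.comp r ((Real.contDiffAt_log.2 hr.ne').div_const l))
  · simp [hφ, (hsupp _ (hout r hr hr')).1]
  · set J : ℝ → ℝ := fun s => w * (deriv χ (s / l) / l - q * χ (s / l)) ^ 2 + w₂ * χ (s / l) ^ 2
      with hJ
    set I : ℝ → ℝ := fun r => (r ^ (2 * q + 2))⁻¹ * J (log r) with hI
    have hIeq : ∀ r, 0 < r → w * deriv φ r ^ 2 + w₂ * (φ r / r) ^ 2 = I r := by
      intro r hr
      rw [hd r hr]
      simp only [hφ, hI, hJ]
      field_simp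
      ring
    have hKm : MeasurableSet {y : EuclideanSpace ℝ (Fin (n + 1)) |
        ‖y‖ ∈ Icc (exp (-2 * l)) (exp (2 * l))} := measurable_norm measurableSet_Icc
    rw [setIntegral_congr_fun (g := fun y => I ‖y‖) hKm fun y hy =>
      hIeq _ ((exp_pos _).trans_le hy.1)]
    rw [setIntegral_eq_integral_of_forall_compl_eq_zero]
    · rw [integral_fun_norm_addHaar volume I]
      have h1 : ∫ y in Ioi (0 : ℝ), y ^ (Module.finrank ℝ (EuclideanSpace ℝ (Fin (n + 1))) - 1) • I y
          = ∫ s, J s := by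
        rw [← integral_Ioi_inv_mul_comp_log]
        refine setIntegral_congr_fun measurableSet_Ioi fun r (hr : 0 < r) => ?_
        simp only [finrank_euclideanSpace, Fintype.card_fin, Nat.add_sub_cancel, smul_eq_mul, hI, hn]
        rw [pow_succ r (2 * q + 1)]
        field_simp
      rw [h1, nsmul_eq_mul, smul_eq_mul]
      refine mul_neg_of_pos_of_neg (Nat.cast_pos.2 Module.finrank_pos)
        (mul_neg_of_pos_of_neg ?_ hneg)
      exact ENNReal.toReal_pos (Metric.measure_ball_pos _ _ one_pos).ne' measure_ball_lt_top.ne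
    · intro y hy
      rcases (norm_nonneg y).eq_or_lt with h0 | h0
      -- At the origin `I` is zero because the inverse of zero is zero.
      · simp [hI, ← h0]
      · obtain ⟨h1, h2⟩ := hsupp _ (hout _ h0 hy)
        simp [hI, hJ, h1, h2]


/-! ### The density factor, its second derivative, and the variation. -/

variable {n m p k : ℕ}

theorem isMinimalImmersionOn_coneMap {f : S n → S m} {θ : ℝ} (ht : IsOfType f p k)
    (hθ : IsLawsonOssermanSphere f θ) : IsMinimalImmersionOn (coneMap f θ) {0}ᶜ := by
  refine isMinimalImmersionOn_cone (fun y hy => ?_) hθ.2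
  rw [radialExt_losMap]
  exact contDiffAt_profileMap ht hy contDiffAt_const contDiffAt_const

/-- Rotating the profile ray `(r cos θ, r sin θ)` by `s` in first order changes the volume density
of a cone by this factor. -/
noncomputable def densityFactor (q : ℕ) (c s Λ x : ℝ) : ℝ :=
  (c - x * s) * ((c - x * s) ^ 2 + (s + x * c) ^ 2 * Λ) ^ q

theorem contDiff_densityFactor (q : ℕ) (c s Λ : ℝ) {r : WithTop ℕ∞} :
    ContDiff ℝ r (densityFactor q c s Λ) := by
  unfold densityFactor
  fun_prop

/-- Together with `c² + s² = 1`, `hangle` gives `c² (Λ - 1) = Λ / (2q + 1)`. This reduces `W₂ + q²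
W(0)` to `c` times a polynomial in `Λ`, whose sign changes at the constants in `hΛ`. -/
theorem exists_densityFactor_derivs {q : ℕ} (hq : q = 1 ∨ q = 2) {c s Λ : ℝ} (hc : 0 < c)
    (hcs : c ^ 2 + s ^ 2 = 1) (hΛ : 25 / 2 < Λ ∨ q = 1 ∧ 9 / 2 < Λ)
    (hangle : c ^ 2 + s ^ 2 * Λ = 2 * q * (Λ - 1) * c ^ 2) :
    ∃ (W' : ℝ → ℝ) (W₂ : ℝ), (∀ x, HasDerivAt (densityFactor q c s Λ) (W' x) x) ∧
      HasDerivAt W' W₂ 0 ∧ W₂ + (q : ℝ) ^ 2 * densityFactor q c s Λ 0 < 0 := by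
  have h1 : ∀ x, HasDerivAt (fun x : ℝ => c - x * s) (-s) x := fun x => by
    simpa using ((hasDerivAt_id x).mul_const s).const_sub c
  have h2 : ∀ x, HasDerivAt (fun x : ℝ => s + x * c) c x := fun x => by
    simpa using ((hasDerivAt_id x).mul_const c).const_add s
  set U : ℝ → ℝ := fun x => (c - x * s) ^ 2 + (s + x * c) ^ 2 * Λ with hU
  set U' : ℝ → ℝ := fun x => -2 * s * (c - x * s) + 2 * c * (s + x * c) * Λ with hU'
  have h3 : ∀ x, HasDerivAt U (U' x) x := fun x => by
    refine (((h1 x).fun_pow 2).fun_add (((h2 x).fun_pow 2).mul_const Λ)).congr_deriv ?_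
    simp only [hU']; push_cast; ring
  have h4 : HasDerivAt U' (2 * (s ^ 2 + Λ * c ^ 2)) 0 := by
    refine (((h1 0).const_mul (-2 * s)).fun_add (((h2 0).const_mul (2 * c)).mul_const Λ)).congr_deriv ?_
    ring
  have hU0 : U 0 = c ^ 2 + s ^ 2 * Λ := by simp [hU]
  have hU'0 : U' 0 = 2 * c * s * (Λ - 1) := by simp only [hU']; ring
  have h5 : ∀ x, HasDerivAt (densityFactor q c s Λ)
      (-s * U x ^ q + (c - x * s) * (q * U x ^ (q - 1) * U' x)) x := fun x =>
    (h1 x).mul ((h3 x).pow q)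
  have h6 := (((h3 0).pow q).const_mul (-s)).add ((h1 0).mul
    ((((h3 0).pow (q - 1)).const_mul (q : ℝ)).mul h4))
  refine ⟨_, _, h5, h6, ?_⟩
  have hΛ1 : 1 < Λ := by rcases hΛ with h | ⟨-, h⟩ <;> linarith
  have hs2 : s ^ 2 = 1 - c ^ 2 := by linarith
  rcases hq with rfl | rfl
  · have hΛ' : 9 / 2 < Λ := by rcases hΛ with h | ⟨-, h⟩ <;> linarith
    have hkey : c ^ 2 * (Λ - 1) = Λ / 3 := by
      rw [hs2] at hangle; push_cast at hangle; linarith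
    -- By `hkey` the bracket is `6 - 4Λ/3`, negative exactly when `Λ > 9/2`.
    have : c * (6 - 4 * Λ + 8 * (c ^ 2 * (Λ - 1))) < 0 :=
      mul_neg_of_pos_of_neg hc (by rw [hkey]; linarith)
    refine lt_of_eq_of_lt ?_ this
    simp [densityFactor, hU0, hU'0]
    linear_combination c * (6 - 3 * Λ) * hs2 - 3 * c * hkey
  · have hΛ' : 25 / 2 < Λ := by rcases hΛ with h | ⟨h, -⟩ <;> [exact h; norm_num at h]
    have hkey : c ^ 2 * (Λ - 1) = Λ / 5 := by
      rw [hs2] at hangle; push_cast at hangle; linarith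
    -- This is the value of `W₂ + 4 W(0)`; the last factor is negative exactly when `Λ > 25/2`.
    have : c * (Λ / 5 * (40 - 16 * Λ / 5)) < 0 :=
      mul_neg_of_pos_of_neg hc (mul_neg_of_pos_of_neg (by linarith) (by linarith))
    have hD : c ^ 2 + s ^ 2 * Λ = 4 * Λ / 5 := by rw [hangle]; push_cast; linarith
    have hsE : s ^ 2 * (Λ - 1) = 4 * Λ / 5 - 1 := by rw [hs2]; linarith
    have hX : s ^ 2 + Λ * c ^ 2 = 1 + Λ / 5 := by rw [hs2]; linarith
    rw [hD] at hU0
    refine lt_of_eq_of_lt ?_ this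
    simp [densityFactor, hU0, hU'0, hD]
    linear_combination (-8 * (4 * Λ / 5) * c + 8 * c * (Λ / 5)) * hsE +
      8 * c * s ^ 2 * (Λ - 1) * hkey + 4 * (4 * Λ / 5) * c * hX

theorem exists_params_of_isTypeII (h : IsTypeII n p k) :
    ∃ q : ℕ, (q = 1 ∨ q = 2) ∧ n = 2 * q + 1 ∧ p = 2 * q ∧ k ≠ 0 ∧
      (25 / 2 < (k * (k + n - 1) / p : ℝ) ∨ q = 1 ∧ 9 / 2 < (k * (k + n - 1) / p : ℝ)) := by
  rcases h with ⟨rfl, rfl, hk⟩ | ⟨rfl, rfl, hk⟩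
  · have hk' : (4 : ℝ) ≤ k := by exact_mod_cast hk
    refine ⟨1, Or.inl rfl, rfl, rfl, by omega, Or.inr ⟨rfl, ?_⟩⟩
    push_cast
    nlinarith
  · have hk' : (6 : ℝ) ≤ k := by exact_mod_cast hk
    refine ⟨2, Or.inr rfl, rfl, rfl, by omega, Or.inl ?_⟩
    push_cast
    nlinarith

/-- The variation of the cone that moves the profile ray by `t φ(r)` in the normal direction
`(-sin θ, cos θ)`. -/
noncomputable def profileVariation (f : S n → S m) (θ : ℝ) (φ : ℝ → ℝ) (t : ℝ) :
    EuclideanSpace ℝ (Fin (n + 1)) → Ambient n m :=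
  profileMap f (fun r => r * cos θ - t * φ r * sin θ) (fun r => r * sin θ + t * φ r * cos θ)

theorem isCompactVariation_profileVariation {f : S n → S m} (ht : IsOfType f p k) (θ : ℝ)
    {φ : ℝ → ℝ} {a b : ℝ} (ha : 0 < a) (hφ : ∀ r, 0 < r → ContDiffAt ℝ ∞ φ r)
    (hφ0 : ∀ r, 0 < r → r ∉ Icc a b → φ r = 0) :
    IsCompactVariation (coneMap f θ) {0}ᶜ (profileVariation f θ φ)
      {y : EuclideanSpace ℝ (Fin (n + 1)) | ‖y‖ ∈ Icc a b} where
  smooth := by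
    rintro ⟨t, y⟩ ⟨-, hy⟩
    have hy0 : y ≠ 0 := hy
    refine ContDiffAt.contDiffWithinAt ?_
    have hsnd : ContDiffAt ℝ ∞ (fun z : ℝ × EuclideanSpace ℝ (Fin (n + 1)) => z.2) (t, y) :=
      contDiffAt_snd
    have hfst : ContDiffAt ℝ ∞ (fun z : ℝ × EuclideanSpace ℝ (Fin (n + 1)) => z.1) (t, y) :=
      contDiffAt_fst
    have hN : ContDiffAt ℝ ∞ (fun z : ℝ × EuclideanSpace ℝ (Fin (n + 1)) => ‖z.2‖) (t, y) :=
      hsnd.norm ℝ hy0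
    have hφN : ContDiffAt ℝ ∞ (fun z : ℝ × EuclideanSpace ℝ (Fin (n + 1)) => φ ‖z.2‖) (t, y) :=
      (hφ _ (norm_pos_iff.2 hy0)).comp (t, y) hN
    have hν : ContDiffAt ℝ ∞ (fun z : ℝ × EuclideanSpace ℝ (Fin (n + 1)) =>
        radialExt (fun x : S n => (x : EuclideanSpace ℝ (Fin (n + 1)))) z.2) (t, y) :=
      ContDiffAt.comp (f := fun z : ℝ × EuclideanSpace ℝ (Fin (n + 1)) => z.2) (t, y)
        (contDiffAt_radialExt_val hy0) hsnd
    have hf : ContDiffAt ℝ ∞ (fun z : ℝ × EuclideanSpace ℝ (Fin (n + 1)) =>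
        radialExt (fun x => (f x : EuclideanSpace ℝ (Fin (m + 1)))) z.2) (t, y) :=
      ContDiffAt.comp (f := fun z : ℝ × EuclideanSpace ℝ (Fin (n + 1)) => z.2) (t, y)
        (contDiffAt_radialExt_of_isOfType ht hy0) hsnd
    exact contDiffAt_toLp_prod
      (((hN.mul contDiffAt_const).sub ((hfst.mul hφN).mul contDiffAt_const)).smul hν)
      (((hN.mul contDiffAt_const).add ((hfst.mul hφN).mul contDiffAt_const)).smul hf)
  zero y _ := by simp [profileVariation, coneMap_eq_profileMap]
  isCompact := by
    refine (isCompact_closedBall (0 : EuclideanSpace ℝ (Fin (n + 1))) b).of_isClosed_subset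
      (isClosed_Icc.preimage continuous_norm) fun y hy => ?_
    simpa using hy.2
  subset y hy := by
    have : 0 < ‖y‖ := ha.trans_le hy.1
    exact norm_pos_iff.1 this
  fixed t y hy hyK := by
    rw [profileVariation, coneMap_eq_profileMap, profileMap, profileMap,
      hφ0 _ (norm_pos_iff.2 hy) hyK]
    simp

/-- The displacement is normal to the ray, so the profile speed squared is `1 + (t φ')²`. Since `p`
is even, the square roots of the stretched directions pair off. The one remaining direction (`n - p
= 1`) contributes `√(a²) / r`, and `hpos` makes this `a / r`. -/
theorem normDet_profileVariation {f : S n → S m} (hf : IsLOMSE f) (ht : IsOfType f p k)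
    (hk : k ≠ 0) {q : ℕ} (hn : n = 2 * q + 1) (hp : p = 2 * q) (hq : q ≠ 0) {Λ : ℝ}
    (hΛ : Λ = k * (k + n - 1) / p) (hΛ0 : 0 ≤ Λ) (θ : ℝ) {φ : ℝ → ℝ} (t : ℝ)
    {y : EuclideanSpace ℝ (Fin (n + 1))} (hy : y ≠ 0) (hφ : DifferentiableAt ℝ φ ‖y‖)
    (hpos : 0 ≤ cos θ - t * (φ ‖y‖ / ‖y‖) * sin θ) :
    (fderiv ℝ (profileVariation f θ φ t) y).toLinearMap.normDet =
      √(1 + (t * deriv φ ‖y‖) ^ 2) *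
        densityFactor q (cos θ) (sin θ) Λ (t * (φ ‖y‖ / ‖y‖)) := by
  have hr : ‖y‖ ≠ 0 := norm_ne_zero_iff.2 hy
  have h1 : HasDerivAt (fun r => r * cos θ - t * φ r * sin θ)
      (cos θ - t * deriv φ ‖y‖ * sin θ) ‖y‖ := by
    simpa using ((hasDerivAt_id ‖y‖).mul_const (cos θ)).fun_sub
      ((hφ.hasDerivAt.const_mul t).mul_const (sin θ))
  have h2 : HasDerivAt (fun r => r * sin θ + t * φ r * cos θ)
      (sin θ + t * deriv φ ‖y‖ * cos θ) ‖y‖ := by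
    simpa using ((hasDerivAt_id ‖y‖).mul_const (sin θ)).fun_add
      ((hφ.hasDerivAt.const_mul t).mul_const (cos θ))
  have h3 : (‖y‖ * cos θ - t * φ ‖y‖ * sin θ) / ‖y‖ = cos θ - t * (φ ‖y‖ / ‖y‖) * sin θ := by
    field_simp
  have h4 : (‖y‖ * sin θ + t * φ ‖y‖ * cos θ) / ‖y‖ = sin θ + t * (φ ‖y‖ / ‖y‖) * cos θ := by
    field_simp
  rw [profileVariation, normDet_profileMap hf ht hk (by omega) hΛ hy h1 h2, h3, h4,
    Real.sqrt_sq hpos, show n - p = 1 by omega, pow_one, hp, pow_mul, Real.sq_sqrt (by positivity),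
    densityFactor]
  congr 2
  linear_combination (1 + (t * deriv φ ‖y‖) ^ 2) * Real.sin_sq_add_cos_sq θ

end LawsonOsserman

theorem theorem1 (n m p k : ℕ) (f : LawsonOsserman.S n → LawsonOsserman.S m) (θ : ℝ)
    (hf : LawsonOsserman.IsLOMSE f)
    (htype : LawsonOsserman.IsOfType f p k)
    (hII : LawsonOsserman.IsTypeII n p k)
    (hθ : LawsonOsserman.IsLawsonOssermanSphere f θ) :
    LawsonOsserman.IsUnstableMinimal (LawsonOsserman.coneMap f θ) {0}ᶜ := by
  open LawsonOsserman in
  refine ⟨isMinimalImmersionOn_coneMap htype hθ, ?_⟩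
  obtain ⟨q, hq, hn, hp, hk, hΛ⟩ := exists_params_of_isTypeII hII
  set Λ : ℝ := k * (k + n - 1) / p with hΛdef
  have hΛ0 : 1 < Λ := by rcases hΛ with h | ⟨-, h⟩ <;> linarith
  have hq0 : q ≠ 0 := by omega
  have hc : 0 < cos θ := cos_pos_of_mem_Ioo ⟨by linarith [hθ.1.1, pi_pos], hθ.1.2⟩
  have hD : 0 < cos θ ^ 2 + sin θ ^ 2 * Λ := by positivity
  have hangle : cos θ ^ 2 + sin θ ^ 2 * Λ = 2 * q * (Λ - 1) * cos θ ^ 2 := by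
    have h := angle_equation hf htype hk (by omega) hθ hΛdef (by linarith)
    have hnp : (n : ℝ) - p = 1 := by rw [hn, hp]; push_cast; ring
    have hp' : (p : ℝ) = 2 * q := by rw [hp]; push_cast; ring
    rw [hnp, hp'] at h
    field_simp at h
    linarith
  obtain ⟨W', W₂, hW1, hW2, hneg⟩ := exists_densityFactor_derivs hq hc
    (by rw [add_comm]; exact Real.sin_sq_add_cos_sq θ) hΛ hangle
  have hW0 : 0 < densityFactor q (cos θ) (sin θ) Λ 0 := by
    simp only [densityFactor, zero_mul, sub_zero, add_zero]
    positivity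
  obtain ⟨φ, a, b, ha, hφ, hφ0, hint⟩ := exists_test_function hn hq0 hW0 hneg
  set K := {y : EuclideanSpace ℝ (Fin (n + 1)) | ‖y‖ ∈ Icc a b} with hKdef
  have hvar := isCompactVariation_profileVariation htype θ ha hφ hφ0
  have hKpos : ∀ y ∈ K, 0 < ‖y‖ := fun y hy => ha.trans_le hy.1
  have hα : ContinuousOn (fun y : EuclideanSpace ℝ (Fin (n + 1)) => deriv φ ‖y‖) K := by
    intro y hy
    have h1 : ContinuousAt (deriv φ) ‖y‖ :=
      ((hφ _ (hKpos y hy)).derivWithin (m := 0) (by simp)).continuousAt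
    exact (ContinuousAt.comp (f := fun y : EuclideanSpace ℝ (Fin (n + 1)) => ‖y‖) h1
      continuous_norm.continuousAt).continuousWithinAt
  have hβ : ContinuousOn (fun y : EuclideanSpace ℝ (Fin (n + 1)) => φ ‖y‖ / ‖y‖) K := by
    intro y hy
    have h1 : ContinuousAt (fun r => φ r / r) ‖y‖ :=
      (hφ _ (hKpos y hy)).continuousAt.div continuousAt_id (hKpos y hy).ne'
    exact (ContinuousAt.comp (f := fun y : EuclideanSpace ℝ (Fin (n + 1)) => ‖y‖) h1
      continuous_norm.continuousAt).continuousWithinAt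
  obtain ⟨V', hV, hV2⟩ := second_variation volume (contDiff_densityFactor q (cos θ) (sin θ) Λ)
    hW1 hW2 hvar.isCompact hα hβ
  refine ⟨profileVariation f θ φ, K, hvar, V', _, ?_, hV2, hint⟩
  obtain ⟨C, hC⟩ := hvar.isCompact.exists_bound_of_continuousOn hβ
  -- For such `t` the first profile component stays nonnegative on `K`, as the density formula
  -- requires.
  have hsmall : ∀ᶠ t in 𝓝 (0 : ℝ), |t| * (|C| + 1) < cos θ := by
    refine (Continuous.tendsto' ?_ 0 0 (by simp)).eventually (gt_mem_nhds hc)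
    fun_prop
  have heq : ∀ᶠ t in 𝓝 (0 : ℝ), volumeOver (profileVariation f θ φ t) K =
      ∫ y in K, √(1 + (t * deriv φ ‖y‖) ^ 2) *
        densityFactor q (cos θ) (sin θ) Λ (t * (φ ‖y‖ / ‖y‖)) := by
    filter_upwards [hsmall] with t ht
    refine setIntegral_congr_fun hvar.isCompact.measurableSet fun y hy => ?_
    refine normDet_profileVariation hf htype hk hn hp hq0 hΛdef (by linarith) θ t
      (norm_pos_iff.1 (hKpos y hy)) ((hφ _ (hKpos y hy)).differentiableAt (by simp)) ?_
    have h1 : |t * (φ ‖y‖ / ‖y‖) * sin θ| ≤ |t| * (|C| + 1) := by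
      rw [abs_mul, abs_mul, mul_assoc]
      refine mul_le_mul_of_nonneg_left ?_ (abs_nonneg t)
      have h2 : |φ ‖y‖ / ‖y‖| ≤ |C| := (hC y hy).trans (le_abs_self C)
      nlinarith [Real.abs_sin_le_one θ, abs_nonneg (φ ‖y‖ / ‖y‖), abs_nonneg (sin θ)]
    linarith [le_abs_self (t * (φ ‖y‖ / ‖y‖) * sin θ)]
  -- Transferring the derivative at `t` needs the volume formula on a whole neighbourhood of `t`.
  filter_upwards [heq.eventually_nhds] with t ht
  exact (hV t).congr_of_eventuallyEq ht
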